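/- Let $A$ be a finite-dimensional commutative $\mathbb Q$-algebra with unit $1_A$. A full lattice in $A$ is a finitely generated $\mathbb Z$-submodule $L\subset A$ that generates $A$ over $\mathbb Q$. For full lattices $L,M$ let $LM$ be the set of finite sums of products $ab$ with $a\in L$, $b\in M$, let $L:M=\{a\in A\mid aM\subset L\}$, and let $\mathcal O(L)=L:L$. An order is a full lattice that is a subring containing $1_A$. If $\Lambda$ is an order, a $\Lambda$-ideal is a full lattice $L$ with $\mathcal O(L)\supset\Lambda$. Full lattices form a commutative semigroup $\mathcal L(A)$ under multiplication. Write $L\sim_\varepsilon M$ if $aL=M$ for some unit $a\in A^\times$; the classes $[L]_\varepsilon$ form a quotient semigroup $\mathcal E(A)$. For an idempotent $c$ of a commutative semigroup $S$ let $G(c)=\{a\in S\mid ac=a,\ \exists\, b\in S:\ ab=c\}$; this is a group with unit element $c$. Orders are idempotent in $\mathcal L(A)$, and their classes are idempotent in $\mathcal E(A)$. For a prime $p$ let $\mathbb Z_{(p)}\subset\mathbb Q$ be the ring of fractions with denominator prime to $p$ and $L_{(p)}=\{qa\mid q\in\mathbb Z_{(p)},\ a\in L\}\subset A$. **Theorem.**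 Let $\Lambda_2\subsetneqq\Lambda_1$ be orders in $A$, let $C:=\Lambda_2:\Lambda_1$ (the conductor, a full lattice), and let $P_0$ be the set of primes $p$ with $(\Lambda_1)_{(p)}\ne(\Lambda_2)_{(p)}$. The set $P_0$ is finite. (a) $\mathcal O(C)\supset\Lambda_1$, and $C$ is the biggest $\Lambda_1$-ideal contained in $\Lambda_2$. (b) The sequence of groups $$1\to\prod_{p\in P_0}(\Lambda_2)_{(p)}^\times\to\prod_{p\in P_0}(\Lambda_1)_{(p)}^\times\xrightarrow{\ \varphi\ }G(\Lambda_2)\to G(\Lambda_1)\to1$$ is exact. Here the first map is the inclusion, the last map is $L\mapsto\Lambda_1L$ (in particular it is surjective), and $\varphi((a_p)_{p\in P_0})$ is, with $a_p:=1_A$ for $p\notin P_0$, the unique full lattice $L$ with $L_{(p)}=a_p(\Lambda_2)_{(p)}$ for all primes $p$, namely $L=\bigcap_p a_p(\Lambda_2)_{(p)}$. (c) There is a natural isomorphism of groups $$\psi:(\Lambda_1/C)^\times/(\Lambda_2/C)^\times\to\prod_{p\in P_0}(\Lambda_1)_{(p)}^\times/(\Lambda_2)_{(p)}^\times .$$ It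 is given as follows: if $a\in\Lambda_1$ and $a+C\in(\Lambda_1/C)^\times$, there are $d_p\in(\Lambda_1)_{(p)}^\times$ with $d_p-a\in C_{(p)}$ for all $p\in P_0$, and for every such choice $\psi$ maps the class of $a+C$ to the class of $(d_p)_{p\in P_0}$. (d) The isomorphism $(\Lambda_1/C)^\times/(\Lambda_2/C)^\times\to\ker(G(\Lambda_2)\to G(\Lambda_1))$ that results from (b) and (c), that is, the one induced by $\varphi$ and $\psi$, maps the class of $a+C$ (with $a\in\Lambda_1$, $a+C\in(\Lambda_1/C)^\times$) to $C+a\Lambda_2$. (e) The sequence of groups $$1\to\Lambda_2^\times\to\Lambda_1^\times\to\prod_{p\in P_0}(\Lambda_1)_{(p)}^\times/(\Lambda_2)_{(p)}^\times\to G([\Lambda_2]_\varepsilon)\to G([\Lambda_1]_\varepsilon)\to1$$ with the natural maps is exact. The first map is the inclusion, the second is the diagonal map, the third maps the class of $(a_p)_{p\in P_0}$ to $[\varphi((a_p)_{p\in P_0})]_\varepsilon$, and the last is $[L]_\varepsilon\mapsto[\Lambda_1L]_\varepsilon$; in particular the last map is surjective. (f) The group $\Lambda_2^\times$ has finite index in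 $\Lambda_1^\times$, the groups $G([\Lambda_1]_\varepsilon)$, $G([\Lambda_2]_\varepsilon)$, $(\Lambda_1/C)^\times$ and $(\Lambda_2/C)^\times$ are finite, and $$\frac{|G([\Lambda_2]_\varepsilon)|}{|G([\Lambda_1]_\varepsilon)|}=\frac{|(\Lambda_1/C)^\times|}{|(\Lambda_2/C)^\times|}\cdot\frac1{[\Lambda_1^\times:\Lambda_2^\times]} .$$ -/

import Mathlib

open scoped Pointwise

namespace QAlg

/-! ### Commutative semigroups: the groups attached to idempotents -/

section Semigroup

variable {S : Type*} [CommSemigroup S]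

/-- `G(c)` for an idempotent `c` of a commutative semigroup: the set of all `a` that are
invertible with `e_a = c`. Here `a` is invertible if there are `b` and `c` with
`a * b = c` and `a * c = a`, and then `c = e_a` is uniquely determined by `a`. -/
def G {c : S} (_hc : IsIdempotentElem c) : Type _ :=
  {a : S // a * c = a ∧ ∃ b, a * b = c}

namespace G

variable {c : S} {hc : IsIdempotentElem c}

theorem ext' {a b : G hc} (h : a.1 = b.1) : a = b := Subtype.ext h

instance : Mul (G hc) where
  mul a b := ⟨a.1 * b.1, by rw [mul_assoc, b.2.1], by
    obtain ⟨x, hx⟩ := a.2.2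
    obtain ⟨y, hy⟩ := b.2.2
    exact ⟨x * y, by rw [mul_mul_mul_comm, hx, hy, hc.eq]⟩⟩

instance : One (G hc) := ⟨⟨c, hc.eq, c, hc.eq⟩⟩

noncomputable instance : Inv (G hc) where
  inv a := ⟨a.2.2.choose * c, by rw [mul_assoc, hc.eq], a.1, by
    rw [mul_comm, ← mul_assoc, a.2.2.choose_spec, hc.eq]⟩

/-- `G(c)` is a group under the multiplication of the semigroup, with unit element `c`. -/
noncomputable instance : CommGroup (G hc) where
  mul_assoc a b d := ext' (mul_assoc a.1 b.1 d.1)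
  one_mul a := ext' ((mul_comm c a.1).trans a.2.1)
  mul_one a := ext' a.2.1
  mul_comm a b := ext' (mul_comm a.1 b.1)
  inv_mul_cancel a := ext' (by
    change a.2.2.choose * c * a.1 = c
    rw [mul_comm, ← mul_assoc, a.2.2.choose_spec, hc.eq])

/-- For idempotents `c`, `d` with `d * c = d`, multiplication with `d` is a group
homomorphism `G(c) → G(d)`. -/
def mulHom {c d : S} (hc : IsIdempotentElem c) (hd : IsIdempotentElem d) (h : d * c = d) :
    G hc →* G hd where
  toFun a := ⟨d * a.1, by rw [mul_right_comm, hd.eq], by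
    obtain ⟨x, hx⟩ := a.2.2
    exact ⟨x, by rw [mul_assoc, hx, h]⟩⟩
  map_one' := ext' h
  map_mul' a b := ext' (by
    change d * (a.1 * b.1) = d * a.1 * (d * b.1)
    rw [mul_mul_mul_comm, hd.eq])

end G

end Semigroup

/-! ### Unit groups modulo unit groups -/

section UnitQuot

variable {R S : Type*} [CommRing R] [CommRing S]

/-- The group `Sˣ / Rˣ` for a (typically injective) ring homomorphism `R → S`: the quotient of
`Sˣ` by the image of `Rˣ`. -/
def UnitQuot (f : R →+* S) : Type _ := Sˣ ⧸ (Units.map (f : R →* S)).range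

instance (f : R →+* S) : CommGroup (UnitQuot f) :=
  inferInstanceAs (CommGroup (Sˣ ⧸ (Units.map (f : R →* S)).range))

/-- The projection `Sˣ → Sˣ / Rˣ`. -/
def UnitQuot.mk (f : R →+* S) : Sˣ →* UnitQuot f :=
  QuotientGroup.mk' (Units.map (f : R →* S)).range

end UnitQuot

/-! ### Full lattices in a finite dimensional commutative `ℚ`-algebra -/

section Lattices

/-- A full lattice in `A`: a finitely generated `ℤ`-submodule which generates `A` over `ℚ`. -/
@[ext]
structure FullLattice (A : Type*) [CommRing A] [Algebra ℚ A] where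
  toSubmodule : Submodule ℤ A
  isLattice : toSubmodule.IsLattice ℚ

variable {A : Type*} [CommRing A] [Algebra ℚ A]

theorem isLattice_mul {L M : Submodule ℤ A} (hL : L.IsLattice ℚ) (hM : M.IsLattice ℚ) :
    (L * M).IsLattice ℚ where
  fg := hL.fg.mul hM.fg
  span_eq_top := by
    rw [eq_top_iff]
    calc (⊤ : Submodule ℚ A) ≤ ⊤ * ⊤ := fun x _ => by
          simpa using Submodule.mul_mem_mul (Submodule.mem_top (R := ℚ) (x := x))
            (Submodule.mem_top (R := ℚ) (x := (1 : A)))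
      _ = Submodule.span ℚ (L : Set A) * Submodule.span ℚ (M : Set A) := by
          rw [hL.span_eq_top, hM.span_eq_top]
      _ = Submodule.span ℚ ((L : Set A) * (M : Set A)) := Submodule.span_mul_span _ _ _
      _ ≤ Submodule.span ℚ ((L * M : Submodule ℤ A) : Set A) := by
          refine Submodule.span_mono ?_
          rintro _ ⟨x, hx, y, hy, rfl⟩
          exact Submodule.mul_mem_mul hx hy

/-- The commutative semigroup of full lattices in `A`, where `L * M` is the set of all finite
sums of products of an element of `L` and an element of `M`. -/
instance : CommSemigroup (FullLattice A) where
  mul L M := ⟨L.toSubmodule * M.toSubmodule, isLattice_mul L.isLattice M.isLattice⟩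
  mul_assoc L M N := FullLattice.ext (mul_assoc L.toSubmodule M.toSubmodule N.toSubmodule)
  mul_comm L M := FullLattice.ext (mul_comm L.toSubmodule M.toSubmodule)

variable (A) in
/-- The `ε`-equivalence `L ∼ M ↔ a L = M` for some unit `a` of `A`. -/
def epsCon : Con (FullLattice A) where
  r L M := ∃ a : Aˣ, (a : A) • L.toSubmodule = M.toSubmodule
  iseqv :=
    { refl := fun L => ⟨1, by simp⟩
      symm := by
        rintro L M ⟨a, ha⟩
        exact ⟨a⁻¹, by rw [← ha, smul_smul]; simp⟩
      trans := by
        rintro L M N ⟨a, ha⟩ ⟨b, hb⟩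
        exact ⟨b * a, by rw [← hb, ← ha, smul_smul]; simp⟩ }
  mul' := by
    rintro L M N K ⟨a, ha⟩ ⟨b, hb⟩
    refine ⟨a * b, ?_⟩
    change ((a * b : Aˣ) : A) • (L.toSubmodule * N.toSubmodule) = M.toSubmodule * K.toSubmodule
    rw [← ha, ← hb, smul_mul_smul_comm]
    simp

variable (A) in
/-- The commutative semigroup of `ε`-classes of full lattices. -/
abbrev EpsClasses : Type _ := (epsCon A).Quotient

/-- The `ε`-class of a full lattice. -/
def epsClass (L : FullLattice A) : EpsClasses A := (L : (epsCon A).Quotient)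

theorem epsClass_mul (L M : FullLattice A) : epsClass (L * M) = epsClass L * epsClass M := rfl

/-! ### Localization at a prime number -/

/-- The subring `ℤ_(p)` of `ℚ`. -/
def ZLoc (p : Nat.Primes) : Subring ℚ where
  carrier := {q | ¬ (p : ℕ) ∣ q.den}
  one_mem' := by simpa using p.2.one_lt.ne'
  zero_mem' := by simpa using p.2.one_lt.ne'
  mul_mem' := fun {a b} ha hb h =>
    ((p.2.dvd_mul).1 (h.trans (Rat.mul_den_dvd a b))).elim ha hb
  add_mem' := fun {a b} ha hb h =>
    ((p.2.dvd_mul).1 (h.trans (Rat.add_den_dvd a b))).elim ha hb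
  neg_mem' := fun {a} ha => by simpa using ha

theorem inv_mem_ZLoc {p : Nat.Primes} {n : ℕ} (hn : ¬ (p : ℕ) ∣ n) : ((n : ℚ)⁻¹) ∈ ZLoc p := by
  have h0 : n ≠ 0 := by rintro rfl; simp at hn
  change ¬ (p : ℕ) ∣ ((n : ℚ)⁻¹).den
  rw [Rat.inv_natCast_den_of_pos (Nat.pos_of_ne_zero h0)]
  exact hn

/-- The localization `L_(p) = {q a | q ∈ ℤ_(p), a ∈ L}`. -/
def localize (p : Nat.Primes) (L : Submodule ℤ A) : Submodule ℤ A where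
  carrier := {x | ∃ q ∈ ZLoc p, ∃ a ∈ L, q • a = x}
  zero_mem' := ⟨0, (ZLoc p).zero_mem, 0, L.zero_mem, by simp⟩
  add_mem' := by
    rintro _ _ ⟨q, hq, a, ha, rfl⟩ ⟨r, hr, b, hb, rfl⟩
    refine ⟨((q.den * r.den : ℕ) : ℚ)⁻¹, inv_mem_ZLoc
      (fun h => ((p.2.dvd_mul).1 h).elim hq hr),
      (q.num * r.den : ℤ) • a + (r.num * q.den : ℤ) • b,
      L.add_mem (L.smul_mem _ ha) (L.smul_mem _ hb), ?_⟩
    have h1 : (q.den : ℚ) ≠ 0 := by exact_mod_cast q.den_nz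
    have h2 : (r.den : ℚ) ≠ 0 := by exact_mod_cast r.den_nz
    rw [← Int.cast_smul_eq_zsmul ℚ, ← Int.cast_smul_eq_zsmul ℚ, smul_add, smul_smul, smul_smul]
    congr 2
    · conv_rhs => rw [← Rat.num_div_den q]
      push_cast
      field_simp
    · conv_rhs => rw [← Rat.num_div_den r]
      push_cast
      field_simp
  smul_mem' := by
    rintro n _ ⟨q, hq, a, ha, rfl⟩
    exact ⟨q, hq, n • a, L.smul_mem n ha, smul_comm q n a⟩

theorem localize_mono (p : Nat.Primes) {L M : Submodule ℤ A} (h : L ≤ M) :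
    localize p L ≤ localize p M := by
  rintro _ ⟨q, hq, a, ha, rfl⟩
  exact ⟨q, hq, a, h ha, rfl⟩

theorem le_localize (p : Nat.Primes) (L : Submodule ℤ A) : L ≤ localize p L :=
  fun a ha => ⟨1, (ZLoc p).one_mem, a, ha, one_smul _ _⟩

/-! ### Orders -/

variable (A) in
/-- An order in `A`: a full lattice which is a subring of `A` containing `1`. -/
structure Order where
  toSubalgebra : Subalgebra ℤ A
  isLattice : (Subalgebra.toSubmodule toSubalgebra).IsLattice ℚ

/-- The inclusion of subrings of `A`. -/
def incl {S T : Subalgebra ℤ A} (h : S ≤ T) : S →+* T := (Subalgebra.inclusion h).toRingHom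

/-- The inclusion of unit groups of subrings of `A`. -/
def unitsIncl {S T : Subalgebra ℤ A} (h : S ≤ T) : Sˣ →* Tˣ :=
  Units.map (incl h : S →* T)

namespace Order

/-- An order as a full lattice. -/
def lattice (Λ : Order A) : FullLattice A := ⟨Subalgebra.toSubmodule Λ.toSubalgebra, Λ.isLattice⟩

theorem lattice_mul {Λ₁ Λ₂ : Order A} (h : Λ₂.toSubalgebra ≤ Λ₁.toSubalgebra) :
    Λ₁.lattice * Λ₂.lattice = Λ₁.lattice := by
  refine FullLattice.ext (le_antisymm (Submodule.mul_le.2 fun x hx y hy => ?_) fun x hx => ?_)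
  · exact Λ₁.toSubalgebra.mul_mem hx (h hy)
  · have h1 : (1 : A) ∈ Λ₂.lattice.toSubmodule := Λ₂.toSubalgebra.one_mem
    have := Submodule.mul_mem_mul hx h1
    rwa [mul_one] at this

theorem idem (Λ : Order A) : IsIdempotentElem Λ.lattice := lattice_mul le_rfl

theorem idemEps (Λ : Order A) : IsIdempotentElem (epsClass Λ.lattice) :=
  congrArg epsClass Λ.idem

/-- The localization `Λ_(p)` as a subring of `A`. -/
def loc (p : Nat.Primes) (Λ : Order A) : Subalgebra ℤ A :=
  (localize p Λ.lattice.toSubmodule).toSubalgebra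
    (le_localize p _ Λ.toSubalgebra.one_mem) (by
      rintro _ _ ⟨q, hq, a, ha, rfl⟩ ⟨r, hr, b, hb, rfl⟩
      exact ⟨q * r, (ZLoc p).mul_mem hq hr, a * b, Λ.toSubalgebra.mul_mem ha hb,
        (smul_mul_smul_comm q a r b).symm⟩)

theorem le_loc (p : Nat.Primes) (Λ : Order A) : Λ.toSubalgebra ≤ Λ.loc p :=
  le_localize p Λ.lattice.toSubmodule

theorem loc_mono (p : Nat.Primes) {Λ₁ Λ₂ : Order A}
    (h : Λ₂.toSubalgebra ≤ Λ₁.toSubalgebra) : Λ₂.loc p ≤ Λ₁.loc p :=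
  fun _ hx => localize_mono p h hx

end Order

/-- The group `G(Λ)` in the semigroup of full lattices. -/
abbrev GLat (Λ : Order A) : Type _ := G Λ.idem

/-- The group `G([Λ]_ε)` in the semigroup of `ε`-classes. -/
abbrev GEps (Λ : Order A) : Type _ := G Λ.idemEps

/-- The homomorphism `G(Λ) → G([Λ]_ε)`, `L ↦ [L]_ε`. -/
def toEps (Λ : Order A) : GLat Λ →* GEps Λ where
  toFun L := ⟨epsClass L.1, by rw [← epsClass_mul, L.2.1], by
    obtain ⟨M, hM⟩ := L.2.2
    exact ⟨epsClass M, by rw [← epsClass_mul, hM]⟩⟩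
  map_one' := rfl
  map_mul' _ _ := rfl

/-! ### A pair of orders -/

variable {Λ₁ Λ₂ : Order A}

/-- The homomorphism `G(Λ₂) → G(Λ₁)`, `L ↦ Λ₁ L`. -/
def extLat (h : Λ₂.toSubalgebra ≤ Λ₁.toSubalgebra) : GLat Λ₂ →* GLat Λ₁ :=
  G.mulHom Λ₂.idem Λ₁.idem (Order.lattice_mul h)

/-- The homomorphism `G([Λ₂]_ε) → G([Λ₁]_ε)`, `[L]_ε ↦ [Λ₁ L]_ε = [Λ₁]_ε [L]_ε`. -/
def extEps (h : Λ₂.toSubalgebra ≤ Λ₁.toSubalgebra) : GEps Λ₂ →* GEps Λ₁ :=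
  G.mulHom Λ₂.idemEps Λ₁.idemEps (congrArg epsClass (Order.lattice_mul h))

/-- The set `P₀` of all prime numbers `p` with `(Λ₁)_(p) ≠ (Λ₂)_(p)`. -/
def P₀ (Λ₁ Λ₂ : Order A) : Set Nat.Primes := {p | Λ₁.loc p ≠ Λ₂.loc p}

/-- A tuple of units of `(Λ₁)_(p)`, `p ∈ P₀`, extended by `a_p := 1` for `p ∉ P₀`. -/
noncomputable def extendByOne (a : ∀ p : P₀ Λ₁ Λ₂, (Λ₁.loc p)ˣ) (p : Nat.Primes) : A :=
  open Classical in if h : p ∈ P₀ Λ₁ Λ₂ then ((a ⟨p, h⟩ : Λ₁.loc p) : A) else 1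

/-- The inclusion `∏ (Λ₂)_(p)ˣ → ∏ (Λ₁)_(p)ˣ` of products over `p ∈ P₀`. -/
def locUnitsIncl (h : Λ₂.toSubalgebra ≤ Λ₁.toSubalgebra) :
    (∀ p : P₀ Λ₁ Λ₂, (Λ₂.loc p)ˣ) →* (∀ p : P₀ Λ₁ Λ₂, (Λ₁.loc p)ˣ) :=
  MonoidHom.piMap fun p => unitsIncl (Order.loc_mono p h)

/-- The quotient group `(Λ₁)_(p)ˣ / (Λ₂)_(p)ˣ`. -/
abbrev LocUnitsQuot (h : Λ₂.toSubalgebra ≤ Λ₁.toSubalgebra) (p : Nat.Primes) : Type _ :=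
  UnitQuot (incl (Order.loc_mono p h))

/-- The natural projection `∏ (Λ₁)_(p)ˣ → ∏ (Λ₁)_(p)ˣ / (Λ₂)_(p)ˣ`. -/
def locUnitsProj (h : Λ₂.toSubalgebra ≤ Λ₁.toSubalgebra) :
    (∀ p : P₀ Λ₁ Λ₂, (Λ₁.loc p)ˣ) →* (∀ p : P₀ Λ₁ Λ₂, LocUnitsQuot h p) :=
  MonoidHom.piMap fun p => UnitQuot.mk (incl (Order.loc_mono p h))

/-- The natural diagonal map `Λ₁ˣ → ∏ (Λ₁)_(p)ˣ / (Λ₂)_(p)ˣ`. -/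
def diagUnits (h : Λ₂.toSubalgebra ≤ Λ₁.toSubalgebra) :
    (Λ₁.toSubalgebra)ˣ →* (∀ p : P₀ Λ₁ Λ₂, LocUnitsQuot h p) :=
  (locUnitsProj h).comp (MonoidHom.pi fun p : P₀ Λ₁ Λ₂ => unitsIncl (Λ₁.le_loc p))

/-- The conductor `C = Λ₂ : Λ₁ = {x ∈ A | x Λ₁ ⊆ Λ₂}`. -/
def relConductor (Λ₁ Λ₂ : Order A) : Submodule ℤ A :=
  Λ₂.lattice.toSubmodule / Λ₁.lattice.toSubmodule

/-- The conductor as an ideal of `Λ₁`. -/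
def conductorIdeal (Λ₁ Λ₂ : Order A) : Ideal Λ₁.toSubalgebra where
  carrier := {x | (x : A) ∈ relConductor Λ₁ Λ₂}
  zero_mem' := (relConductor Λ₁ Λ₂).zero_mem
  add_mem' := fun ha hb => (relConductor Λ₁ Λ₂).add_mem ha hb
  smul_mem' := fun c x hx y hy => by
    have := hx ((c : A) * y) (Λ₁.toSubalgebra.mul_mem c.2 hy)
    change (c : A) * (x : A) * y ∈ _
    rwa [mul_comm (c : A), mul_assoc]

/-- The conductor as an ideal of `Λ₂`. -/
def conductorIdeal' (h : Λ₂.toSubalgebra ≤ Λ₁.toSubalgebra) : Ideal Λ₂.toSubalgebra :=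
  (conductorIdeal Λ₁ Λ₂).comap (incl h)

/-- The ring `Λ₁/C`. -/
abbrev ModC (Λ₁ Λ₂ : Order A) : Type _ := Λ₁.toSubalgebra ⧸ conductorIdeal Λ₁ Λ₂

/-- The ring `Λ₂/C`. -/
abbrev ModC' (h : Λ₂.toSubalgebra ≤ Λ₁.toSubalgebra) : Type _ :=
  Λ₂.toSubalgebra ⧸ conductorIdeal' h

/-- The natural ring homomorphism `Λ₂/C → Λ₁/C`. -/
def modCIncl (h : Λ₂.toSubalgebra ≤ Λ₁.toSubalgebra) : ModC' h →+* ModC Λ₁ Λ₂ :=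
  Ideal.quotientMap (conductorIdeal Λ₁ Λ₂) (incl h) le_rfl

/-- The group `(Λ₁/C)ˣ / (Λ₂/C)ˣ`. -/
abbrev ModCUnitsQuot (h : Λ₂.toSubalgebra ≤ Λ₁.toSubalgebra) : Type _ :=
  UnitQuot (modCIncl h)

end Lattices

end QAlg

open QAlg

/-!
A lattice is determined by its localizations at the primes, since `L = ⋂ L_(p)`
(`iInf_localize`), and a full lattice may be replaced by another one at finitely many primes
(`exists_glue`). A lattice in `G(Λ)` is locally principal, `L_(p) = a_p Λ_(p)` with `a_p ∈ Aˣ`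
(`GLat.exists_localize_eq`): only finitely many maximal ideals of `Λ` contain `p`, and an element
outside all of them is a unit of `Λ_(p)` (`Order.exists_mul_eq_one_of_forall_notMem`).

Glueing gives the homomorphism `glueHom` from the local units to `G(Λ₂)`. If `Λ₁ L = Λ₁`, the
local generators of `L` are units of `(Λ₁)_(p)`, which is exactness at `G(Λ₂)`; surjectivity of
`G(Λ₂) → G(Λ₁)` comes from the glueing of `a_p (Λ₂)_(p)`, `p ∈ P₀`, into a lattice with
localizations `a_p (Λ₁)_(p)`.

For the conductor `C`, the local component `C_(p)` is an ideal of `(Λ₁)_(p)` inside `(Λ₂)_(p)`, and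
`C_(p) = (Λ₁)_(p)` for `p ∉ P₀`. A unit of `Λ₁/C` lifts to units of the localizations by the choice
of a representative outside the maximal ideals over `p` (`exists_represents`), and every tuple of
local units is approximated modulo `C_(p)` by one element of `Λ₁` (`exists_mem_represents`). This
gives the isomorphism `modCUnitsEquiv`, and the formula `C + aΛ₂` is checked prime by prime
(`Represents.glueHom_eq`). The sequence of classes follows from the sequence of lattices because
`G(Λ) → G([Λ]_ε)` is surjective with kernel the principal lattices `aΛ`, `a ∈ Aˣ`.

Finiteness of `G([Λ]_ε)` (`finite_GEps`) is reduced to ideal class groups of number fields. The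
class of an invertible lattice is determined by that of its image in the reduced algebra
(`toEps_eq_one_of_map`). A reduced algebra is a product of number fields; there the exact sequence
of classes transfers finiteness from the maximal order to `Λ` (`finite_GEps_of_le`), and over the
maximal order a lattice is the product of its components, which are fractional ideals
(`finite_GEps_maximalOrder`). The class number formula is then a count along the exact sequence.
-/

namespace QAlg

/-! ### Localization of lattices at primes -/

section FullLattices

variable {A : Type*} [CommRing A] [Algebra ℚ A]

theorem mem_localize_iff {p : Nat.Primes} {L : Submodule ℤ A} {x : A} :
    x ∈ localize p L ↔ ∃ n : ℕ, ¬ (p : ℕ) ∣ n ∧ n • x ∈ L := by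
  constructor
  · rintro ⟨q, hq, a, ha, rfl⟩
    refine ⟨q.den, hq, ?_⟩
    have h : q.den • (q • a) = q.num • a := by
      rw [← Nat.cast_smul_eq_nsmul ℚ, ← Int.cast_smul_eq_zsmul ℚ, smul_smul, Rat.den_mul_eq_num]
    rw [h]
    exact L.smul_mem _ ha
  · rintro ⟨n, hn, hx⟩
    refine ⟨(n : ℚ)⁻¹, inv_mem_ZLoc hn, n • x, hx, ?_⟩
    have h0 : (n : ℚ) ≠ 0 := by
      rw [Nat.cast_ne_zero]; rintro rfl; simp at hn
    rw [← Nat.cast_smul_eq_nsmul ℚ, smul_smul, inv_mul_cancel₀ h0, one_smul]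

theorem not_dvd_mul {p : Nat.Primes} {m n : ℕ} (hm : ¬ (p : ℕ) ∣ m) (hn : ¬ (p : ℕ) ∣ n) :
    ¬ (p : ℕ) ∣ m * n := fun h => (p.2.dvd_mul.1 h).elim hm hn

theorem mem_localize_of_nsmul_mem {p : Nat.Primes} {L : Submodule ℤ A} {x : A} {n : ℕ}
    (hn : ¬ (p : ℕ) ∣ n) (hx : n • x ∈ localize p L) : x ∈ localize p L := by
  obtain ⟨m, hm, h⟩ := mem_localize_iff.1 hx
  exact mem_localize_iff.2 ⟨m * n, not_dvd_mul hm hn, by rwa [mul_smul]⟩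

theorem localize_le_localize_of_le {p : Nat.Primes} {L M : Submodule ℤ A}
    (h : L ≤ localize p M) : localize p L ≤ localize p M := fun _ hx => by
  obtain ⟨n, hn, hx⟩ := mem_localize_iff.1 hx
  exact mem_localize_of_nsmul_mem hn (h hx)

theorem localize_mul (p : Nat.Primes) (L M : Submodule ℤ A) :
    localize p (L * M) = localize p L * localize p M := by
  apply le_antisymm
  · intro x hx
    obtain ⟨q, hq, a, ha, rfl⟩ := hx
    induction ha using Submodule.mul_induction_on' with
    | mem_mul_mem m hm n hn =>
      rw [← smul_mul_assoc]
      exact Submodule.mul_mem_mul ⟨q, hq, m, hm, rfl⟩ (le_localize p M hn)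
    | add x _ y _ h1 h2 => rw [smul_add]; exact add_mem h1 h2
  · rw [Submodule.mul_le]
    rintro _ ⟨q, hq, a, ha, rfl⟩ _ ⟨r, hr, b, hb, rfl⟩
    exact ⟨q * r, (ZLoc p).mul_mem hq hr, a * b, Submodule.mul_mem_mul ha hb,
      (smul_mul_smul_comm q a r b).symm⟩

theorem localize_sup (p : Nat.Primes) (L M : Submodule ℤ A) :
    localize p (L ⊔ M) = localize p L ⊔ localize p M := by
  apply le_antisymm
  · rintro _ ⟨q, hq, a, ha, rfl⟩
    obtain ⟨l, hl, m, hm, rfl⟩ := Submodule.mem_sup.1 ha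
    rw [smul_add]
    exact Submodule.add_mem_sup ⟨q, hq, l, hl, rfl⟩ ⟨q, hq, m, hm, rfl⟩
  · exact sup_le (localize_mono p le_sup_left) (localize_mono p le_sup_right)

theorem localize_smul (p : Nat.Primes) (a : A) (L : Submodule ℤ A) :
    localize p (a • L) = a • localize p L := by
  ext x
  constructor
  · rintro ⟨q, hq, y, hy, rfl⟩
    obtain ⟨l, hl, rfl⟩ := (Submodule.mem_smul_pointwise_iff_exists _ _ _).1 hy
    rw [smul_comm]
    exact Submodule.smul_mem_pointwise_smul _ _ _ ⟨q, hq, l, hl, rfl⟩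
  · intro hx
    obtain ⟨y, ⟨q, hq, l, hl, rfl⟩, rfl⟩ := (Submodule.mem_smul_pointwise_iff_exists _ _ _).1 hx
    rw [smul_comm]
    exact ⟨q, hq, _, Submodule.smul_mem_pointwise_smul _ _ _ hl, rfl⟩

/-- An element that lies in all localizations of `L` lies in `L`: the integers `n` with
`n x ∈ L` form an ideal of `ℤ` that no prime contains. -/
theorem mem_of_forall_mem_localize {L : Submodule ℤ A} {x : A}
    (h : ∀ p, x ∈ localize p L) : x ∈ L := by
  by_contra hx
  let I : Ideal ℤ := L.comap (LinearMap.toSpanSingleton ℤ A x)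
  have hmem : ∀ n : ℤ, n ∈ I ↔ n • x ∈ L := fun n => Iff.rfl
  have hI : (Submodule.IsPrincipal.generator I).natAbs ≠ 1 := by
    intro h1
    have h2 : I = ⊤ := by
      rw [← Ideal.span_singleton_generator I, Ideal.span_singleton_eq_top]
      exact Int.isUnit_iff_natAbs_eq.2 h1
    exact hx (by simpa [hmem] using (I.eq_top_iff_one.1 h2))
  obtain ⟨p, hp, hd⟩ := Nat.exists_prime_and_dvd hI
  obtain ⟨n, hn, hnx⟩ := mem_localize_iff.1 (h ⟨p, hp⟩)
  have h3 : (n : ℤ) ∈ I := by rw [hmem]; simpa using hnx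
  rw [← Ideal.span_singleton_generator I, Ideal.mem_span_singleton] at h3
  exact hn (hd.trans (by simpa using Int.natAbs_dvd_natAbs.2 h3))

theorem iInf_localize (L : Submodule ℤ A) : ⨅ p, localize p L = L :=
  le_antisymm (fun _ hx => mem_of_forall_mem_localize ((Submodule.mem_iInf _).1 hx))
    (le_iInf fun p => le_localize p L)

theorem le_of_forall_localize_le {L M : Submodule ℤ A}
    (h : ∀ p, localize p L ≤ localize p M) : L ≤ M := fun _ hx =>
  mem_of_forall_mem_localize fun p => h p (le_localize p L hx)

theorem eq_of_forall_localize_eq {L M : Submodule ℤ A}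
    (h : ∀ p, localize p L = localize p M) : L = M :=
  le_antisymm (le_of_forall_localize_le fun p => (h p).le)
    (le_of_forall_localize_le fun p => (h p).ge)

/-! ### Comparing and glueing full lattices -/

theorem exists_nsmul_mem {M : Submodule ℤ A} (hM : M.IsLattice ℚ) (x : A) :
    ∃ n : ℕ, n ≠ 0 ∧ n • x ∈ M := by
  have hx : x ∈ Submodule.span ℚ (M : Set A) := by rw [hM.span_eq_top]; trivial
  induction hx using Submodule.span_induction with
  | mem x h => exact ⟨1, one_ne_zero, by simpa using h⟩
  | zero => exact ⟨1, one_ne_zero, by simp⟩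
  | add x y _ _ h1 h2 =>
    obtain ⟨m, hm, hmx⟩ := h1
    obtain ⟨n, hn, hny⟩ := h2
    refine ⟨m * n, mul_ne_zero hm hn, ?_⟩
    rw [smul_add, mul_comm m n, mul_smul, mul_comm n m, mul_smul m n]
    exact add_mem (M.nsmul_mem hmx n) (M.nsmul_mem hny m)
  | smul q x _ h =>
    obtain ⟨m, hm, hmx⟩ := h
    refine ⟨m * q.den, mul_ne_zero hm q.den_nz, ?_⟩
    have h : (m * q.den) • (q • x) = q.num • (m • x) := by
      rw [mul_smul, ← Nat.cast_smul_eq_nsmul ℚ q.den, smul_smul, Rat.den_mul_eq_num,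
        Int.cast_smul_eq_zsmul, smul_comm]
    rw [h]
    exact M.smul_mem _ hmx

theorem exists_nsmul_le {B : Type*} [AddCommGroup B] {L M : Submodule ℤ B} (hL : L.FG)
    (hM : ∀ x ∈ L, ∃ n : ℕ, n ≠ 0 ∧ n • x ∈ M) :
    ∃ n : ℕ, n ≠ 0 ∧ ∀ x ∈ L, n • x ∈ M := by
  obtain ⟨s, rfl⟩ := hL
  choose! f hf hfm using hM
  refine ⟨∏ x ∈ s, f x, Finset.prod_ne_zero_iff.2 fun x hx => hf x (Submodule.subset_span hx),
    fun x hx => ?_⟩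
  induction hx using Submodule.span_induction with
  | mem x h =>
    obtain ⟨k, hk⟩ := Finset.dvd_prod_of_mem f h
    rw [hk, mul_comm, mul_smul]
    exact M.nsmul_mem (hfm x (Submodule.subset_span h)) _
  | zero => simp
  | add x y _ _ h1 h2 => rw [smul_add]; exact add_mem h1 h2
  | smul q x _ h => rw [smul_comm]; exact M.smul_mem _ h

theorem exists_nsmul_le_of_isLattice {L M : Submodule ℤ A} (hL : L.IsLattice ℚ)
    (hM : M.IsLattice ℚ) : ∃ n : ℕ, n ≠ 0 ∧ ∀ x ∈ L, n • x ∈ M :=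
  exists_nsmul_le hL.fg fun x _ => exists_nsmul_mem hM x

/-- A finitely generated `L` inside `M_(p)` is carried into `M` by one integer prime to `p`. -/
theorem exists_not_dvd_nsmul_le {p : Nat.Primes} {L M : Submodule ℤ A} (hL : L.FG)
    (h : L ≤ localize p M) : ∃ n : ℕ, ¬ (p : ℕ) ∣ n ∧ ∀ x ∈ L, n • x ∈ M := by
  obtain ⟨s, rfl⟩ := hL
  have hM := fun x hx => mem_localize_iff.1 (h (x := x) hx)
  choose! f hf hfm using hM
  refine ⟨∏ x ∈ s, f x, fun hd => ?_, fun x hx => ?_⟩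
  · obtain ⟨x, hx, hd⟩ := (Nat.Prime.prime p.2).exists_mem_finset_dvd hd
    exact hf x (Submodule.subset_span hx) hd
  induction hx using Submodule.span_induction with
  | mem x h =>
    obtain ⟨k, hk⟩ := Finset.dvd_prod_of_mem f h
    rw [hk, mul_comm, mul_smul]
    exact M.nsmul_mem (hfm x (Submodule.subset_span h)) _
  | zero => simp
  | add x y _ _ h1 h2 => rw [smul_add]; exact add_mem h1 h2
  | smul q x _ h => rw [smul_comm]; exact M.smul_mem _ h

theorem isLattice_of_nsmul_le {L M : Submodule ℤ A} (hL : L.IsLattice ℚ) (hM : M.FG) {n : ℕ}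
    (hn : n ≠ 0) (h : ∀ x ∈ L, n • x ∈ M) : M.IsLattice ℚ where
  fg := hM
  span_eq_top := by
    rw [eq_top_iff, ← hL.span_eq_top, Submodule.span_le]
    intro x hx
    have h1 : (n : ℚ)⁻¹ • (n • x) = x := by
      rw [← Nat.cast_smul_eq_nsmul ℚ, smul_smul, inv_mul_cancel₀ (by exact_mod_cast hn), one_smul]
    rw [← h1]
    exact Submodule.smul_mem _ _ (Submodule.subset_span (h x hx))

theorem isLattice_units_smul (a : Aˣ) {L : Submodule ℤ A} (hL : L.IsLattice ℚ) :
    ((a : A) • L).IsLattice ℚ where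
  fg := hL.fg.map (DistribSMul.toLinearMap ℤ A (a : A))
  span_eq_top := by
    rw [eq_top_iff]
    intro x _
    have hx : (↑a⁻¹ : A) * x ∈ Submodule.span ℚ (L : Set A) := by rw [hL.span_eq_top]; trivial
    have h1 : ∀ y ∈ Submodule.span ℚ (L : Set A),
        (a : A) * y ∈ Submodule.span ℚ (((a : A) • L : Submodule ℤ A) : Set A) := by
      intro y hy
      induction hy using Submodule.span_induction with
      | mem y h => exact Submodule.subset_span (Submodule.smul_mem_pointwise_smul _ (a : A) _ h)
      | zero => simp
      | add y z _ _ h1 h2 => rw [mul_add]; exact add_mem h1 h2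
      | smul q y _ h => rw [mul_smul_comm]; exact Submodule.smul_mem _ _ h
    simpa using h1 _ hx

/-- Multiplication of a full lattice with a unit of `A`. -/
def FullLattice.unitSMul (a : Aˣ) (L : FullLattice A) : FullLattice A :=
  ⟨(a : A) • L.toSubmodule, isLattice_units_smul a L.isLattice⟩

theorem le_localize_of_nsmul {p : Nat.Primes} {L M : Submodule ℤ A} {n : ℕ}
    (hn : ¬ (p : ℕ) ∣ n) (h : ∀ x ∈ L, n • x ∈ M) : localize p L ≤ localize p M :=
  localize_le_localize_of_le fun x hx => mem_localize_iff.2 ⟨n, hn, h x hx⟩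

/-- A full lattice can be changed at one prime: with `n L ≤ M`, `n M ≤ L` and `n = p ^ k * m`
where `m` is prime to `p`, the lattice `p ^ k L + m M` agrees with `M` at `p` and with `L` at
all other primes. -/
theorem exists_glue_one (L M : FullLattice A) (p : Nat.Primes) :
    ∃ K : FullLattice A, localize p K.toSubmodule = localize p M.toSubmodule ∧
      ∀ q, q ≠ p → localize q K.toSubmodule = localize q L.toSubmodule := by
  obtain ⟨a, ha, haL⟩ := exists_nsmul_le_of_isLattice L.isLattice M.isLattice
  obtain ⟨b, hb, hbM⟩ := exists_nsmul_le_of_isLattice M.isLattice L.isLattice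
  obtain ⟨k, m, hm, hn⟩ := Nat.exists_eq_pow_mul_and_not_dvd (mul_ne_zero ha hb) p p.2.ne_one
  have hmu : ∀ n : ℕ, n ≠ 0 → ∃ u : Aˣ, (u : A) = n := fun n hn => by
    have h0 : IsUnit ((n : ℚ)) := isUnit_iff_ne_zero.2 (by exact_mod_cast hn)
    obtain ⟨u, hu⟩ := h0.map (algebraMap ℚ A)
    exact ⟨u, by simpa using hu⟩
  have hm0 : m ≠ 0 := by rintro rfl; simp at hm
  obtain ⟨u, hu⟩ := hmu (p ^ k) (pow_ne_zero _ p.2.ne_zero)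
  obtain ⟨v, hv⟩ := hmu m hm0
  have hLM : ∀ x ∈ L.toSubmodule, (a * b) • x ∈ M.toSubmodule := fun x hx => by
    rw [mul_comm, mul_smul]; exact M.toSubmodule.nsmul_mem (haL x hx) _
  have hML : ∀ x ∈ M.toSubmodule, (a * b) • x ∈ L.toSubmodule := fun x hx => by
    rw [mul_smul]; exact L.toSubmodule.nsmul_mem (hbM x hx) _
  have : (L.unitSMul u).toSubmodule.IsLattice ℚ := (L.unitSMul u).isLattice
  have : (M.unitSMul v).toSubmodule.IsLattice ℚ := (M.unitSMul v).isLattice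
  have key : ∀ (q : Nat.Primes) (X Y : Submodule ℤ A) (r s : ℕ), ¬ (q : ℕ) ∣ s →
      (∀ x ∈ X, (s * r) • x ∈ Y) →
      localize q ((r : A) • X) ⊔ localize q ((s : A) • Y) = localize q Y := by
    intro q X Y r s hs h
    have h1 : localize q ((s : A) • Y) = localize q Y := by
      refine le_antisymm (localize_mono q ?_) (le_localize_of_nsmul hs fun x hx => ?_)
      · rintro x hx
        obtain ⟨y, hy, rfl⟩ := (Submodule.mem_smul_pointwise_iff_exists _ _ _).1 hx
        simpa using Y.nsmul_mem hy s
      · simpa using Submodule.smul_mem_pointwise_smul _ (s : A) _ hx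
    rw [h1, sup_eq_right]
    refine le_localize_of_nsmul hs fun x hx => ?_
    obtain ⟨y, hy, rfl⟩ := (Submodule.mem_smul_pointwise_iff_exists _ _ _).1 hx
    have := h y hy
    rw [mul_smul] at this
    simpa using this
  refine ⟨⟨(L.unitSMul u).toSubmodule ⊔ (M.unitSMul v).toSubmodule, inferInstance⟩, ?_, ?_⟩
  · change localize p ((u : A) • L.toSubmodule ⊔ (v : A) • M.toSubmodule) = _
    rw [localize_sup, hu, hv]
    exact key p _ _ _ m hm fun x hx => by rw [mul_comm, ← hn]; exact hLM x hx
  · intro q hq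
    change localize q ((u : A) • L.toSubmodule ⊔ (v : A) • M.toSubmodule) = _
    rw [localize_sup, hu, hv, sup_comm]
    refine key q _ _ m (p ^ k) (fun h => hq ?_) fun x hx => by rw [← hn]; exact hML x hx
    exact Subtype.ext ((Nat.prime_dvd_prime_iff_eq q.2 p.2).1 (q.2.dvd_of_dvd_pow h))

theorem exists_glue (L : FullLattice A) (M : Nat.Primes → FullLattice A)
    {P : Set Nat.Primes} (hP : P.Finite) :
    ∃ K : FullLattice A, (∀ p ∈ P, localize p K.toSubmodule = localize p (M p).toSubmodule) ∧
      ∀ p, p ∉ P → localize p K.toSubmodule = localize p L.toSubmodule := by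
  induction P, hP using Set.Finite.induction_on with
  | empty => exact ⟨L, by simp, by simp⟩
  | @insert p P hp _ ih =>
    obtain ⟨K, h1, h2⟩ := ih
    obtain ⟨K', h3, h4⟩ := exists_glue_one K (M p) p
    refine ⟨K', fun q hq => ?_, fun q hq => ?_⟩
    · rcases hq with rfl | hq
      · exact h3
      · rw [h4 q (by rintro rfl; exact hp hq), h1 q hq]
    · rw [Set.mem_insert_iff, not_or] at hq
      rw [h4 q hq.1, h2 q hq.2]

end FullLattices

/-! ### Finitely many maximal ideals -/

/-- A unit modulo `I` has a representative outside any given finite set of maximal ideals. -/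
theorem exists_sub_mem_forall_notMem {R : Type*} [CommRing R] (T : Finset (Ideal R))
    (hT : ∀ m ∈ T, m.IsMaximal) (I : Ideal R) {a b : R} (hab : a * b - 1 ∈ I) :
    ∃ z, z - a ∈ I ∧ ∀ m ∈ T, z ∉ m := by
  classical
  have htop : I ⊔ (T.filter fun m => ¬ I ≤ m).inf id = ⊤ := by
    by_contra hne
    obtain ⟨N, hN, hle⟩ := Ideal.exists_le_maximal _ hne
    obtain ⟨m, hm, hmN⟩ := (Ideal.IsPrime.inf_le' hN.isPrime).1 (le_sup_right.trans hle)
    rw [Finset.mem_filter] at hm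
    have := (hT m hm.1).eq_of_le hN.ne_top hmN
    subst this
    exact hm.2 (le_sup_left.trans hle)
  obtain ⟨i, hi, j, hj, hij⟩ := Submodule.mem_sup.1 ((Ideal.eq_top_iff_one _).1 htop)
  refine ⟨a + i * (1 - a), by simpa using I.mul_mem_right _ hi, fun m hm hz => ?_⟩
  have hmax := hT m hm
  by_cases hIm : I ≤ m
  · -- modulo `m` the element is `a`, a unit
    have ha : a ∈ m := by
      have := m.sub_mem hz (m.mul_mem_right (1 - a) (hIm hi))
      simpa using this
    apply hmax.ne_top
    rw [Ideal.eq_top_iff_one]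
    have := m.sub_mem (m.mul_mem_right b ha) (hIm hab)
    simpa using this
  · -- modulo `m` the element is `1`, since `i` is
    have hjm : j ∈ m := Finset.inf_le (f := id) (Finset.mem_filter.2 ⟨hm, hIm⟩) hj
    apply hmax.ne_top
    rw [Ideal.eq_top_iff_one]
    have := m.add_mem hz (m.mul_mem_right (1 - a) hjm)
    have h1 : a + i * (1 - a) + j * (1 - a) = 1 := by
      linear_combination (1 - a) * hij
    rwa [h1] at this

/-- In a finite set of maximal ideals each one has an element outside it that lies in all
the others. -/
theorem exists_notMem_forall_mem {R : Type*} [CommRing R] (T : Finset (Ideal R))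
    (hT : ∀ m ∈ T, m.IsMaximal) {m : Ideal R} (hm : m ∈ T) :
    ∃ e, e ∉ m ∧ ∀ n ∈ T, n ≠ m → e ∈ n := by
  classical
  have h : ¬ (T.erase m).inf id ≤ m := fun hle => by
    obtain ⟨n, hn, hnm⟩ := (Ideal.IsPrime.inf_le' (hT m hm).isPrime).1 hle
    rw [Finset.mem_erase] at hn
    exact hn.1 ((hT n hn.2).eq_of_le (hT m hm).ne_top hnm)
  obtain ⟨e, he, hem⟩ := SetLike.not_le_iff_exists.1 h
  exact ⟨e, hem, fun n hn hnm => Finset.inf_le (f := id) (Finset.mem_erase.2 ⟨hnm, hn⟩) he⟩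

/-! ### Units of localized orders and invertible lattices -/

section LocalUnits

variable {A : Type*} [CommRing A] [Algebra ℚ A]

namespace Order

variable (Λ : Order A)

instance : Module.Finite ℤ Λ.toSubalgebra := Module.Finite.iff_fg.2 Λ.isLattice.fg

theorem finite_quotient {I : Ideal Λ.toSubalgebra} {n : ℕ} (hn : n ≠ 0)
    (hI : (n : Λ.toSubalgebra) ∈ I) : Finite (Λ.toSubalgebra ⧸ I) := by
  refine Module.finite_of_fg_torsion _ fun {x} => ?_
  refine ⟨⟨(n : ℤ), mem_nonZeroDivisors_of_ne_zero (by exact_mod_cast hn)⟩, ?_⟩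
  obtain ⟨y, rfl⟩ := Ideal.Quotient.mk_surjective x
  change (n : ℤ) • Ideal.Quotient.mk I y = 0
  rw [zsmul_eq_mul, Int.cast_natCast, ← map_natCast (Ideal.Quotient.mk I), ← map_mul,
    Ideal.Quotient.eq_zero_iff_mem]
  exact I.mul_mem_right _ hI

theorem finite_maximal_over (p : Nat.Primes) :
    {m : Ideal Λ.toSubalgebra | m.IsMaximal ∧ ((p : ℕ) : Λ.toSubalgebra) ∈ m}.Finite := by
  have hf : Finite (Λ.toSubalgebra ⧸ Ideal.span {((p : ℕ) : Λ.toSubalgebra)}) :=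
    Λ.finite_quotient p.2.ne_zero (Ideal.subset_span rfl)
  have hf' : Finite (Ideal (Λ.toSubalgebra ⧸ Ideal.span {((p : ℕ) : Λ.toSubalgebra)})) :=
    Finite.of_injective _ SetLike.coe_injective
  refine (Set.finite_range (Ideal.comap (Ideal.Quotient.mk
    (Ideal.span {((p : ℕ) : Λ.toSubalgebra)})))).subset ?_
  rintro m ⟨-, hm⟩
  refine ⟨m.map (Ideal.Quotient.mk _), Ideal.comap_map_mk ?_⟩
  rwa [Ideal.span_singleton_le_iff_mem]

/-- An element of `Λ` outside all maximal ideals over `p` is a unit of `Λ_(p)`: by Nakayama's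
lemma over `ℤ`, the quotient `Λ / zΛ = p (Λ / zΛ)` is killed by an integer prime to `p`. -/
theorem exists_mul_eq_one_of_forall_notMem (p : Nat.Primes) (z : Λ.toSubalgebra)
    (hz : ∀ m : Ideal Λ.toSubalgebra, m.IsMaximal → ((p : ℕ) : Λ.toSubalgebra) ∈ m → z ∉ m) :
    ∃ w ∈ Λ.loc p, (z : A) * w = 1 := by
  have htop : Ideal.span {z} ⊔ Ideal.span {((p : ℕ) : Λ.toSubalgebra)} = ⊤ := by
    by_contra hne
    obtain ⟨N, hN, hle⟩ := Ideal.exists_le_maximal _ hne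
    rw [sup_le_iff, Ideal.span_singleton_le_iff_mem, Ideal.span_singleton_le_iff_mem] at hle
    exact hz N hN hle.2 hle.1
  obtain ⟨i, hi, j, hj, hij⟩ := Submodule.mem_sup.1 ((Ideal.eq_top_iff_one _).1 htop)
  obtain ⟨j, rfl⟩ := Ideal.mem_span_singleton.1 hj
  obtain ⟨r, hr, hr0⟩ := Submodule.exists_sub_one_mem_and_smul_eq_zero_of_fg_of_le_smul
    (Ideal.span {((p : ℕ) : ℤ)}) (⊤ : Submodule ℤ (Λ.toSubalgebra ⧸ Ideal.span {z}))
    Module.Finite.fg_top (by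
      rintro x -
      obtain ⟨y, rfl⟩ := Ideal.Quotient.mk_surjective x
      have h1 : Ideal.Quotient.mk (Ideal.span {z}) y =
          ((p : ℕ) : ℤ) • Ideal.Quotient.mk (Ideal.span {z}) (j * y) := by
        rw [zsmul_eq_mul, Int.cast_natCast, ← map_natCast (Ideal.Quotient.mk (Ideal.span {z})),
          ← map_mul, Ideal.Quotient.eq]
        have : y - ((p : ℕ) : Λ.toSubalgebra) * (j * y) = i * y := by
          linear_combination (-y) * hij
        rw [this]
        exact Ideal.mul_mem_right _ _ hi
      rw [h1]
      exact Submodule.smul_mem_smul (Ideal.subset_span rfl) trivial)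
  have h2 := hr0 (Ideal.Quotient.mk _ 1) trivial
  rw [zsmul_eq_mul, ← map_intCast (Ideal.Quotient.mk (Ideal.span {z})), ← map_mul,
    Ideal.Quotient.eq_zero_iff_mem, mul_one, Ideal.mem_span_singleton] at h2
  obtain ⟨w, hw⟩ := h2
  have hr1 : ¬ (p : ℕ) ∣ r.natAbs := by
    rw [← Int.natCast_dvd]
    intro hd
    rw [Ideal.mem_span_singleton] at hr
    have := (dvd_sub_right hd).1 hr
    exact p.2.one_lt.ne' (by simpa using Int.natAbs_dvd_natAbs.2 this)
  have hr2 : (r : ℚ) ≠ 0 := by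
    rw [Int.cast_ne_zero]; rintro rfl; simp at hr1
  have hw' : (z : A) * w = (r : A) := by
    have := congrArg (Subtype.val) hw
    simpa using this.symm
  refine ⟨(r : ℚ)⁻¹ • (w : A), mem_localize_iff.2 ⟨r.natAbs, hr1, ?_⟩, ?_⟩
  · have h3 : r • ((r : ℚ)⁻¹ • (w : A)) = w := by
      rw [← Int.cast_smul_eq_zsmul ℚ, smul_smul, mul_inv_cancel₀ hr2, one_smul]
    rcases Int.natAbs_eq r with h | h
    · rw [← natCast_zsmul, ← h, h3]; exact w.2
    · rw [← natCast_zsmul, ← neg_neg ((r.natAbs : ℕ) : ℤ), ← h, neg_smul, h3]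
      exact neg_mem w.2
  · rw [mul_smul_comm, hw', show (r : A) = algebraMap ℚ A r by simp, 
      Algebra.smul_def, ← map_mul, inv_mul_cancel₀ hr2, map_one]

/-- A unit of `Λ` modulo an ideal `I` has a representative that is a unit of `Λ_(p)`. -/
theorem exists_unit_loc_sub_mem (p : Nat.Primes) (I : Ideal Λ.toSubalgebra)
    {a b : Λ.toSubalgebra} (hab : a * b - 1 ∈ I) :
    ∃ (z : Λ.toSubalgebra) (u : (Λ.loc p)ˣ), z - a ∈ I ∧ ((u : Λ.loc p) : A) = z := by
  obtain ⟨z, hz, hm⟩ := exists_sub_mem_forall_notMem (Λ.finite_maximal_over p).toFinset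
    (fun m hm => ((Set.Finite.mem_toFinset _).1 hm).1) I hab
  obtain ⟨w, hw, hzw⟩ := Λ.exists_mul_eq_one_of_forall_notMem p z fun m h1 h2 =>
    hm m ((Set.Finite.mem_toFinset _).2 ⟨h1, h2⟩)
  exact ⟨z, Units.mkOfMulEqOne ⟨(z : A), Λ.le_loc p z.2⟩ ⟨w, hw⟩ (Subtype.ext hzw), hz, rfl⟩

end Order

/-- Invertible lattices are locally principal. For each of the finitely many maximal ideals `m`
over `p` there are `x ∈ L`, `y ∈ L⁻¹` with `x * y ∉ m`, and these combine to one pair that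
works for all of them. -/
theorem GLat.exists_localize_eq {Λ : Order A} (L : GLat Λ) (p : Nat.Primes) :
    ∃ a : Aˣ, localize p L.1.toSubmodule = (a : A) • localize p Λ.lattice.toSubmodule := by
  classical
  obtain ⟨hL, M, hM⟩ := L.2
  have hL : L.1.toSubmodule * Λ.lattice.toSubmodule = L.1.toSubmodule :=
    congrArg FullLattice.toSubmodule hL
  have hM : L.1.toSubmodule * M.toSubmodule = Λ.lattice.toSubmodule :=
    congrArg FullLattice.toSubmodule hM
  have hmul : ∀ x ∈ L.1.toSubmodule, ∀ y ∈ M.toSubmodule, x * y ∈ Λ.toSubalgebra :=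
    fun x hx y hy => by
      change x * y ∈ Λ.lattice.toSubmodule
      rw [← hM]; exact Submodule.mul_mem_mul hx hy
  have hLΛ : ∀ x ∈ L.1.toSubmodule, ∀ y ∈ Λ.toSubalgebra, x * y ∈ L.1.toSubmodule :=
    fun x hx y hy => by rw [← hL]; exact Submodule.mul_mem_mul hx hy
  set T := (Λ.finite_maximal_over p).toFinset
  have hT : ∀ m, m ∈ T ↔ (m.IsMaximal ∧ ((p : ℕ) : Λ.toSubalgebra) ∈ m) :=
    fun m => Set.Finite.mem_toFinset _
  have hex : ∀ m ∈ T, ∃ x ∈ L.1.toSubmodule, ∃ y ∈ M.toSubmodule,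
      ∀ z : Λ.toSubalgebra, (z : A) = x * y → z ∉ m := by
    intro m hm
    by_contra! hcon
    have hle : L.1.toSubmodule * M.toSubmodule ≤
        (m.restrictScalars ℤ).map Λ.toSubalgebra.val.toLinearMap := by
      rw [Submodule.mul_le]
      intro x hx y hy
      obtain ⟨z, hz, hzm⟩ := hcon x hx y hy
      exact ⟨z, hzm, hz⟩
    rw [hM] at hle
    obtain ⟨z, hz, h1⟩ := hle Λ.toSubalgebra.one_mem
    have : z = 1 := Subtype.ext h1
    subst this
    exact ((hT m).1 hm).1.ne_top ((Ideal.eq_top_iff_one _).2 hz)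
  have hex' : ∀ m ∈ T, ∃ e : Λ.toSubalgebra, e ∉ m ∧ ∀ n ∈ T, n ≠ m → e ∈ n := fun m hm =>
    exists_notMem_forall_mem T (fun m hm => ((hT m).1 hm).1) hm
  choose! x hx y hy hxy using hex
  choose! e he hen using hex'
  have hX : ∑ m ∈ T, x m * (e m : A) ∈ L.1.toSubmodule :=
    sum_mem fun m hm => hLΛ _ (hx m hm) _ (e m).2
  -- `M` need not be a `Λ`-module, so `∑ y m * e m` need not lie in `M`, but it maps `L` to `Λ`
  have hY : ∀ z ∈ L.1.toSubmodule, z * ∑ m ∈ T, y m * (e m : A) ∈ Λ.toSubalgebra := by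
    intro z hz
    rw [Finset.mul_sum]
    refine sum_mem fun m hm => ?_
    rw [← mul_assoc]
    exact Λ.toSubalgebra.mul_mem (hmul _ hz _ (hy m hm)) (e m).2
  obtain ⟨w, hw, hzw⟩ := Λ.exists_mul_eq_one_of_forall_notMem p ⟨_, hY _ hX⟩ (by
    intro m hmax hpm hmem
    have hmT : m ∈ T := (hT m).2 ⟨hmax, hpm⟩
    let c : Ideal Λ.toSubalgebra → Ideal Λ.toSubalgebra → Λ.toSubalgebra := fun i j =>
      if h : i ∈ T ∧ j ∈ T then ⟨x i * y j, hmul _ (hx i h.1) _ (hy j h.2)⟩ else 0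
    have hc : ∀ i ∈ T, ∀ j ∈ T, (c i j : A) = x i * y j := fun i hi j hj => by
      simp only [c, dif_pos (And.intro hi hj)]
    have heq : (⟨_, hY _ hX⟩ : Λ.toSubalgebra) = ∑ i ∈ T, ∑ j ∈ T, c i j * (e i * e j) := by
      apply Subtype.ext
      push_cast
      rw [Finset.sum_mul_sum]
      refine Finset.sum_congr rfl fun i hi => Finset.sum_congr rfl fun j hj => ?_
      rw [hc i hi j hj]; ring
    rw [heq, ← Finset.add_sum_erase _ _ hmT] at hmem
    have h1 := (Ideal.add_mem_iff_left m (sum_mem fun i hi => sum_mem fun j hj => by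
      rw [Finset.mem_erase] at hi
      exact m.mul_mem_left _ (m.mul_mem_right _ (hen i hi.2 m hmT hi.1.symm)))).1 hmem
    rw [← Finset.add_sum_erase _ _ hmT] at h1
    have h2 := (Ideal.add_mem_iff_left m (sum_mem fun j hj => by
      rw [Finset.mem_erase] at hj
      exact m.mul_mem_left _ (m.mul_mem_left _ (hen j hj.2 m hmT hj.1.symm)))).1 h1
    rcases hmax.isPrime.mem_or_mem h2 with h3 | h3
    · exact hxy m hmT _ (hc m hmT m hmT) h3
    · rcases hmax.isPrime.mem_or_mem h3 with h3 | h3 <;> exact he m hmT h3)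
  set X := ∑ m ∈ T, x m * (e m : A)
  set Y := ∑ m ∈ T, y m * (e m : A)
  have hXYw : X * (Y * w) = 1 := by rw [← mul_assoc]; exact hzw
  refine ⟨Units.mkOfMulEqOne X (Y * w) hXYw, le_antisymm ?_ ?_⟩
  · change _ ≤ X • _
    rw [← localize_smul]
    refine localize_le_localize_of_le fun l hl => ?_
    rw [localize_smul]
    have h4 : l = X • (l * Y * w) := by
      rw [smul_eq_mul]; linear_combination (-l) * hXYw
    rw [h4]
    exact Submodule.smul_mem_pointwise_smul _ _ _
      ((Λ.loc p).mul_mem (Λ.le_loc p (hY l hl)) hw)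
  · change X • _ ≤ _
    rw [← localize_smul]
    refine localize_mono p ?_
    intro l hl
    obtain ⟨y, hy, rfl⟩ := (Submodule.mem_smul_pointwise_iff_exists _ _ _).1 hl
    exact hLΛ _ hX _ hy

end LocalUnits

/-! ### Units of subrings and of localizations -/

section Subrings

variable {A : Type*} [CommRing A]

theorem subalgebra_units_coe_injective (S : Subalgebra ℤ A) :
    Function.Injective fun u : Sˣ => ((u : S) : A) :=
  Subtype.val_injective.comp Units.val_injective

/-- A unit of a subring of `A`, as a unit of `A`. -/
def subUnits (S : Subalgebra ℤ A) : Sˣ →* Aˣ := Units.map (S.val : S →* A)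

@[simp] theorem coe_subUnits (S : Subalgebra ℤ A) (u : Sˣ) : (subUnits S u : A) = (u : S) := rfl

@[simp] theorem coe_unitsIncl {S T : Subalgebra ℤ A} (h : S ≤ T) (u : Sˣ) :
    ((unitsIncl h u : T) : A) = (u : S) := rfl

theorem unitsIncl_injective {S T : Subalgebra ℤ A} (h : S ≤ T) :
    Function.Injective (unitsIncl h) := fun _ _ huv =>
  subalgebra_units_coe_injective S (congrArg (fun w : Tˣ => ((w : T) : A)) huv)

theorem exists_unit_of_mem {S : Subalgebra ℤ A} {a b : A} (ha : a ∈ S) (hb : b ∈ S)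
    (hab : a * b = 1) : ∃ u : Sˣ, ((u : S) : A) = a :=
  ⟨Units.mkOfMulEqOne ⟨a, ha⟩ ⟨b, hb⟩ (Subtype.ext hab), rfl⟩

theorem mem_range_unitsIncl_iff {S T : Subalgebra ℤ A} (h : S ≤ T) (u : Tˣ) :
    u ∈ Set.range (unitsIncl h) ↔ ((u : T) : A) ∈ S ∧ ((u⁻¹ : Tˣ) : T).1 ∈ S := by
  constructor
  · rintro ⟨v, rfl⟩
    refine ⟨(v : S).2, ?_⟩
    rw [← map_inv]
    exact ((v⁻¹ : Sˣ) : S).2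
  · rintro ⟨h1, h2⟩
    obtain ⟨v, hv⟩ := exists_unit_of_mem h1 h2 (congrArg Subtype.val u.mul_inv)
    exact ⟨v, subalgebra_units_coe_injective T hv⟩

theorem smul_subalgebra_eq_iff {S : Subalgebra ℤ A} (a : Aˣ) :
    (a : A) • Subalgebra.toSubmodule S = Subalgebra.toSubmodule S ↔
      ∃ u : Sˣ, ((u : S) : A) = a := by
  constructor
  · intro h
    have h1 : (a : A) ∈ S := by
      have := Submodule.smul_mem_pointwise_smul _ (a : A) (Subalgebra.toSubmodule S) S.one_mem
      rw [h] at this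
      simpa using this
    have h2 : (1 : A) ∈ (a : A) • Subalgebra.toSubmodule S := by rw [h]; exact S.one_mem
    obtain ⟨b, hb, hab⟩ := (Submodule.mem_smul_pointwise_iff_exists _ _ _).1 h2
    exact exists_unit_of_mem h1 hb hab
  · rintro ⟨u, hu⟩
    rw [← hu]
    ext x
    constructor
    · intro hx
      obtain ⟨y, hy, rfl⟩ := (Submodule.mem_smul_pointwise_iff_exists _ _ _).1 hx
      exact S.mul_mem (u : S).2 hy
    · intro hx
      have h1 : x = ((u : S) : A) • (((u⁻¹ : Sˣ) : S) * x : A) := by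
        rw [smul_eq_mul, ← mul_assoc, show ((u : S) : A) * ((u⁻¹ : Sˣ) : S) = 1 from
          congrArg Subtype.val u.mul_inv, one_mul]
      rw [h1]
      exact Submodule.smul_mem_pointwise_smul _ _ _ (S.mul_mem ((u⁻¹ : Sˣ) : S).2 hx)

end Subrings

section LatticesFromUnits

variable {A : Type*} [CommRing A] [Algebra ℚ A]

theorem FullLattice.ext_localize {L M : FullLattice A}
    (h : ∀ p, localize p L.toSubmodule = localize p M.toSubmodule) : L = M :=
  FullLattice.ext (eq_of_forall_localize_eq h)

theorem FullLattice.mul_toSubmodule (L M : FullLattice A) :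
    (L * M).toSubmodule = L.toSubmodule * M.toSubmodule := rfl

theorem Order.localize_mul_localize {Λ₁ Λ₂ : Order A} (h : Λ₂.toSubalgebra ≤ Λ₁.toSubalgebra)
    (p : Nat.Primes) : localize p Λ₁.lattice.toSubmodule * localize p Λ₂.lattice.toSubmodule =
      localize p Λ₁.lattice.toSubmodule := by
  rw [← localize_mul]
  exact congrArg (fun L => localize p (FullLattice.toSubmodule L)) (Order.lattice_mul h)

/-- A full lattice is invertible over `Λ` if it is locally principal and the inverses of its
local generators also belong to a full lattice. -/
def mkGLat {Λ : Order A} (u : Nat.Primes → Aˣ) (K K' : FullLattice A)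
    (hK : ∀ p, localize p K.toSubmodule = (u p : A) • localize p Λ.lattice.toSubmodule)
    (hK' : ∀ p, localize p K'.toSubmodule =
      (((u p)⁻¹ : Aˣ) : A) • localize p Λ.lattice.toSubmodule) : GLat Λ :=
  ⟨K, FullLattice.ext_localize fun p => by
      rw [FullLattice.mul_toSubmodule, localize_mul, hK, smul_mul_assoc,
        Order.localize_mul_localize le_rfl],
    K', FullLattice.ext_localize fun p => by
      rw [FullLattice.mul_toSubmodule, localize_mul, hK, hK', smul_mul_smul_comm,
        Order.localize_mul_localize le_rfl]
      simp⟩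

/-! ### The homomorphism from local units to invertible lattices -/

theorem finite_P₀ (Λ₁ Λ₂ : Order A) : (P₀ Λ₁ Λ₂).Finite := by
  obtain ⟨a, ha, h1⟩ := exists_nsmul_le_of_isLattice Λ₁.isLattice Λ₂.isLattice
  obtain ⟨b, hb, h2⟩ := exists_nsmul_le_of_isLattice Λ₂.isLattice Λ₁.isLattice
  refine Set.Finite.of_finite_image (f := Subtype.val)
    (((a * b).divisors.finite_toSet).subset ?_) Subtype.val_injective.injOn
  rintro _ ⟨p, hp, rfl⟩
  rw [Finset.mem_coe, Nat.mem_divisors]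
  refine ⟨?_, mul_ne_zero ha hb⟩
  by_contra hd
  refine hp (Subalgebra.toSubmodule_injective (le_antisymm ?_ ?_))
  · exact le_localize_of_nsmul (fun h => hd (h.mul_right b)) h1
  · exact le_localize_of_nsmul (fun h => hd (h.mul_left a)) h2

variable {Λ₁ Λ₂ : Order A}

theorem localize_eq_of_notMem {p : Nat.Primes} (hp : p ∉ P₀ Λ₁ Λ₂) :
    localize p Λ₁.lattice.toSubmodule = localize p Λ₂.lattice.toSubmodule :=
  congrArg Subalgebra.toSubmodule (not_not.1 hp)

/-- The values of `extendByOne` as units of `A`. -/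
noncomputable def extendUnits (a : ∀ p : P₀ Λ₁ Λ₂, (Λ₁.loc p)ˣ) (p : Nat.Primes) : Aˣ :=
  open Classical in if h : p ∈ P₀ Λ₁ Λ₂ then subUnits _ (a ⟨p, h⟩) else 1

theorem coe_extendUnits (a : ∀ p : P₀ Λ₁ Λ₂, (Λ₁.loc p)ˣ) (p : Nat.Primes) :
    (extendUnits a p : A) = extendByOne a p := by
  unfold extendUnits extendByOne
  split_ifs <;> rfl

theorem extendUnits_of_mem (a : ∀ p : P₀ Λ₁ Λ₂, (Λ₁.loc p)ˣ) (p : P₀ Λ₁ Λ₂) :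
    extendUnits a p = subUnits _ (a p) := dif_pos p.2

theorem extendUnits_of_notMem (a : ∀ p : P₀ Λ₁ Λ₂, (Λ₁.loc p)ˣ) {p : Nat.Primes}
    (hp : p ∉ P₀ Λ₁ Λ₂) : extendUnits a p = 1 := dif_neg hp

theorem extendUnits_mul (a b : ∀ p : P₀ Λ₁ Λ₂, (Λ₁.loc p)ˣ) (p : Nat.Primes) :
    extendUnits (a * b) p = extendUnits a p * extendUnits b p := by
  unfold extendUnits
  split_ifs <;> simp

theorem extendUnits_inv (a : ∀ p : P₀ Λ₁ Λ₂, (Λ₁.loc p)ˣ) (p : Nat.Primes) :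
    extendUnits a⁻¹ p = (extendUnits a p)⁻¹ := by
  unfold extendUnits
  split_ifs <;> simp

theorem exists_localize_eq_extendUnits (a : ∀ p : P₀ Λ₁ Λ₂, (Λ₁.loc p)ˣ) :
    ∃ K : FullLattice A, ∀ p, localize p K.toSubmodule =
      (extendUnits a p : A) • localize p Λ₂.lattice.toSubmodule := by
  obtain ⟨K, h1, h2⟩ := exists_glue Λ₂.lattice
    (fun p => Λ₂.lattice.unitSMul (extendUnits a p)) (finite_P₀ Λ₁ Λ₂)
  refine ⟨K, fun p => ?_⟩
  by_cases hp : p ∈ P₀ Λ₁ Λ₂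
  · rw [h1 p hp, ← localize_smul]; rfl
  · rw [h2 p hp, extendUnits_of_notMem a hp, Units.val_one, one_smul]

/-- The full lattice with localizations `a_p (Λ₂)_(p)`. -/
noncomputable def glueUnits (a : ∀ p : P₀ Λ₁ Λ₂, (Λ₁.loc p)ˣ) : FullLattice A :=
  (exists_localize_eq_extendUnits a).choose

theorem localize_glueUnits (a : ∀ p : P₀ Λ₁ Λ₂, (Λ₁.loc p)ˣ) (p : Nat.Primes) :
    localize p (glueUnits a).toSubmodule =
      (extendUnits a p : A) • localize p Λ₂.lattice.toSubmodule :=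
  (exists_localize_eq_extendUnits a).choose_spec p

variable (Λ₁ Λ₂) in
/-- The homomorphism `∏ (Λ₁)_(p)ˣ → G(Λ₂)` that sends `(a_p)` to the full lattice with
localizations `a_p (Λ₂)_(p)`. -/
noncomputable def glueHom : (∀ p : P₀ Λ₁ Λ₂, (Λ₁.loc p)ˣ) →* GLat Λ₂ :=
  MonoidHom.mk' (fun a => mkGLat (extendUnits a) (glueUnits a) (glueUnits a⁻¹)
    (localize_glueUnits a) fun p => by rw [localize_glueUnits, extendUnits_inv]) fun a b =>
    G.ext' (FullLattice.ext_localize fun p => by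
      change localize p (glueUnits (a * b)).toSubmodule =
        localize p ((glueUnits a).toSubmodule * (glueUnits b).toSubmodule)
      rw [localize_mul, localize_glueUnits, localize_glueUnits, localize_glueUnits,
        smul_mul_smul_comm, extendUnits_mul, Order.localize_mul_localize le_rfl, Units.val_mul])

theorem localize_glueHom (a : ∀ p : P₀ Λ₁ Λ₂, (Λ₁.loc p)ˣ) (p : Nat.Primes) :
    localize p (glueHom Λ₁ Λ₂ a).1.toSubmodule =
      (extendUnits a p : A) • localize p Λ₂.lattice.toSubmodule :=
  localize_glueUnits a p

theorem eq_glueHom_iff (a : ∀ p : P₀ Λ₁ Λ₂, (Λ₁.loc p)ˣ) (L : FullLattice A) :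
    L = (glueHom Λ₁ Λ₂ a).1 ↔ ∀ p, localize p L.toSubmodule =
      (extendUnits a p : A) • localize p Λ₂.lattice.toSubmodule := by
  constructor
  · rintro rfl p
    exact localize_glueHom a p
  · intro h
    exact FullLattice.ext_localize fun p => by rw [h, localize_glueHom]

variable (h : Λ₂.toSubalgebra ≤ Λ₁.toSubalgebra)

theorem locUnitsIncl_injective : Function.Injective (locUnitsIncl h) := fun _ _ hab =>
  funext fun p => unitsIncl_injective (Order.loc_mono p h) (congrFun hab p)

theorem glueHom_eq_one_iff (a : ∀ p : P₀ Λ₁ Λ₂, (Λ₁.loc p)ˣ) :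
    glueHom Λ₁ Λ₂ a = 1 ↔ a ∈ Set.range (locUnitsIncl h) := by
  have h1 : glueHom Λ₁ Λ₂ a = 1 ↔ Λ₂.lattice = (glueHom Λ₁ Λ₂ a).1 :=
    ⟨fun h => by rw [h]; rfl, fun h => G.ext' h.symm⟩
  rw [h1, eq_glueHom_iff]
  constructor
  · intro hp
    have := fun p : P₀ Λ₁ Λ₂ =>
      (smul_subalgebra_eq_iff (S := Λ₂.loc p) (extendUnits a p)).1 (hp p).symm
    choose u hu using this
    refine ⟨u, funext fun p => subalgebra_units_coe_injective _ ?_⟩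
    exact (hu p).trans (by rw [extendUnits_of_mem]; rfl)
  · rintro ⟨u, rfl⟩ p
    by_cases hp : p ∈ P₀ Λ₁ Λ₂
    · refine ((smul_subalgebra_eq_iff (S := Λ₂.loc p) _).2 ⟨u ⟨p, hp⟩, ?_⟩).symm
      rw [extendUnits_of_mem _ ⟨p, hp⟩]; rfl
    · rw [extendUnits_of_notMem _ hp, Units.val_one, one_smul]

theorem extLat_eq_one_iff (L : GLat Λ₂) :
    extLat h L = 1 ↔ L ∈ Set.range (glueHom Λ₁ Λ₂) := by
  have hdef : ∀ L : GLat Λ₂, extLat h L = 1 ↔ Λ₁.lattice * L.1 = Λ₁.lattice := fun L =>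
    ⟨fun h => congrArg Subtype.val h, fun h => G.ext' h⟩
  rw [hdef]
  constructor
  · intro hL
    choose a ha using L.exists_localize_eq
    have h1 : ∀ p, (a p : A) • localize p Λ₁.lattice.toSubmodule =
        localize p Λ₁.lattice.toSubmodule := fun p => by
      conv_rhs => rw [← hL, FullLattice.mul_toSubmodule, localize_mul, ha, mul_smul_comm,
        Order.localize_mul_localize h]
    have h2 := fun p => (smul_subalgebra_eq_iff (S := Λ₁.loc p) (a p)).1 (h1 p)
    choose u hu using h2
    refine ⟨fun p => u p, G.ext' (((eq_glueHom_iff _ _).2 fun p => ?_).symm)⟩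
    by_cases hp : p ∈ P₀ Λ₁ Λ₂
    · rw [ha, extendUnits_of_mem _ ⟨p, hp⟩, coe_subUnits, hu]
    · rw [extendUnits_of_notMem _ hp, ha, ← localize_eq_of_notMem hp, h1, Units.val_one, one_smul]
  · rintro ⟨a, rfl⟩
    refine FullLattice.ext_localize fun p => ?_
    rw [FullLattice.mul_toSubmodule, localize_mul, localize_glueHom, mul_smul_comm,
      Order.localize_mul_localize h]
    by_cases hp : p ∈ P₀ Λ₁ Λ₂
    · exact (smul_subalgebra_eq_iff (S := Λ₁.loc p) _).2
        ⟨a ⟨p, hp⟩, by rw [extendUnits_of_mem _ ⟨p, hp⟩]; rfl⟩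
    · rw [extendUnits_of_notMem _ hp, Units.val_one, one_smul]

/-- `G(Λ₂) → G(Λ₁)` is surjective: for `L` with localizations `a_p (Λ₁)_(p)` there is a full
lattice with localizations `a_p (Λ₂)_(p)`, since this changes `L` at finitely many primes. -/
theorem extLat_surjective : Function.Surjective (extLat h) := by
  intro L
  choose a ha using L.exists_localize_eq
  have hinv : ∀ p, localize p (L⁻¹).1.toSubmodule =
      (((a p)⁻¹ : Aˣ) : A) • localize p Λ₁.lattice.toSubmodule := fun p => by
    have h1 : L.1 * (L⁻¹).1 = Λ₁.lattice := congrArg Subtype.val (mul_inv_cancel L)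
    have h2 : (L⁻¹).1 * Λ₁.lattice = (L⁻¹).1 := (L⁻¹).2.1
    conv_rhs => rw [← h1, FullLattice.mul_toSubmodule, localize_mul, ha, smul_mul_assoc,
      smul_smul, Units.inv_mul, one_smul, ← localize_mul, mul_comm]
    exact congrArg (fun M => localize p (FullLattice.toSubmodule M)) h2.symm
  have key : ∀ (M : FullLattice A) (u : Nat.Primes → Aˣ), (∀ p, localize p M.toSubmodule =
      (u p : A) • localize p Λ₁.lattice.toSubmodule) → ∃ K : FullLattice A,
      ∀ p, localize p K.toSubmodule = (u p : A) • localize p Λ₂.lattice.toSubmodule := by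
    intro M u hu
    obtain ⟨K, h1, h2⟩ := exists_glue M (fun p => Λ₂.lattice.unitSMul (u p)) (finite_P₀ Λ₁ Λ₂)
    refine ⟨K, fun p => ?_⟩
    by_cases hp : p ∈ P₀ Λ₁ Λ₂
    · rw [h1 p hp, ← localize_smul]; rfl
    · rw [h2 p hp, hu, localize_eq_of_notMem hp]
  obtain ⟨K, hK⟩ := key L.1 a ha
  obtain ⟨K', hK'⟩ := key (L⁻¹).1 (fun p => (a p)⁻¹) hinv
  refine ⟨mkGLat a K K' hK hK', G.ext' (FullLattice.ext_localize fun p => ?_)⟩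
  change localize p (Λ₁.lattice.toSubmodule * K.toSubmodule) = _
  rw [localize_mul, hK, mul_smul_comm, Order.localize_mul_localize h, ha]

end LatticesFromUnits

/-! ### Simultaneous approximation -/

section Approximation

variable {A : Type*} [CommRing A] [Algebra ℚ A]

/-- Chinese remainder theorem: local elements `x_p ∈ L_(p)` at finitely many primes are
approximated modulo a sublattice `M` by one element of `L`. In the induction step the
approximation at the old primes is kept by a correction in `e L`, where `n = p ^ k * e`
with `e` prime to `p` is such that `n L ≤ M`. -/
theorem exists_sub_mem_localize {L M : Submodule ℤ A} {n : ℕ} (hn : n ≠ 0)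
    (hLM : ∀ x ∈ L, n • x ∈ M) {P : Set Nat.Primes} (hP : P.Finite) (x : Nat.Primes → A)
    (hx : ∀ p ∈ P, x p ∈ localize p L) :
    ∃ a ∈ L, ∀ p ∈ P, x p - a ∈ localize p M := by
  induction P, hP using Set.Finite.induction_on with
  | empty => exact ⟨0, L.zero_mem, by simp⟩
  | @insert p P hp _ ih =>
    obtain ⟨a, ha, hap⟩ := ih fun q hq => hx q (Set.mem_insert_of_mem _ hq)
    obtain ⟨k, e, he, hne⟩ := Nat.exists_eq_pow_mul_and_not_dvd hn p p.2.ne_one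
    have hy : x p - a ∈ localize p L :=
      sub_mem (hx p (Set.mem_insert _ _)) (le_localize p L ha)
    obtain ⟨s, hs, hsy⟩ := mem_localize_iff.1 hy
    have hcop : IsCoprime ((s * e : ℕ) : ℤ) ((p ^ k : ℕ) : ℤ) :=
      Nat.isCoprime_iff_coprime.2
        (((Nat.Prime.coprime_iff_not_dvd p.2).2 (not_dvd_mul hs he)).symm.pow_right k)
    obtain ⟨t, r, htr⟩ := hcop
    refine ⟨a + (e : ℤ) • (t • (s • (x p - a))), L.add_mem ha
      (L.smul_mem _ (L.smul_mem _ hsy)), fun q hq => ?_⟩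
    rcases hq with rfl | hq
    · have h1 : x q - (a + (e : ℤ) • (t • (s • (x q - a)))) =
          r • (((q : ℕ) ^ k) • (x q - a)) := by
        have htr' : (t : A) * (s * e) + r * (q : ℕ) ^ k = 1 := by
          have := congrArg (Int.cast : ℤ → A) htr
          push_cast at this
          exact this
        simp only [zsmul_eq_mul, nsmul_eq_mul]
        push_cast
        linear_combination (-(x q - a)) * htr'
      rw [h1]
      refine Submodule.smul_mem _ _ (mem_localize_of_nsmul_mem (not_dvd_mul hs he)
        (le_localize q M ?_))
      have h2 : (s * e) • (((q : ℕ) ^ k) • (x q - a)) = n • (s • (x q - a)) := by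
        rw [smul_smul, smul_smul, hne]; congr 1; ring
      rw [h2]
      exact hLM _ hsy
    · have hqp : ¬ (q : ℕ) ∣ (p : ℕ) ^ k := fun hd => hp (by
        rwa [← show q = p from
          Subtype.ext ((Nat.prime_dvd_prime_iff_eq q.2 p.2).1 (q.2.dvd_of_dvd_pow hd))])
      rw [← sub_sub]
      refine sub_mem (hap q hq) (mem_localize_iff.2 ⟨_, hqp, ?_⟩)
      have h2 : ((p : ℕ) ^ k) • ((e : ℤ) • (t • (s • (x p - a)))) =
          t • (n • (s • (x p - a))) := by
        rw [hne, natCast_zsmul, smul_smul, smul_comm]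
      rw [h2]
      exact M.smul_mem _ (hLM _ hsy)

end Approximation

/-! ### The conductor -/

section Conductor

variable {A : Type*} [CommRing A] [Algebra ℚ A] {Λ₁ Λ₂ : Order A}

theorem mem_relConductor {x : A} :
    x ∈ relConductor Λ₁ Λ₂ ↔ ∀ y ∈ Λ₁.toSubalgebra, x * y ∈ Λ₂.toSubalgebra :=
  Submodule.mem_div_iff_forall_mul_mem

theorem relConductor_le : relConductor Λ₁ Λ₂ ≤ Λ₂.lattice.toSubmodule := fun x hx => by
  have := mem_relConductor.1 hx 1 Λ₁.toSubalgebra.one_mem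
  rwa [mul_one] at this

theorem mul_mem_relConductor {x y : A} (hx : x ∈ relConductor Λ₁ Λ₂)
    (hy : y ∈ Λ₁.toSubalgebra) : x * y ∈ relConductor Λ₁ Λ₂ :=
  mem_relConductor.2 fun z hz => by
    rw [mul_assoc]; exact mem_relConductor.1 hx _ (Λ₁.toSubalgebra.mul_mem hy hz)

variable (Λ₁ Λ₂) in
theorem exists_nsmul_mem_relConductor :
    ∃ n : ℕ, n ≠ 0 ∧ ∀ x ∈ Λ₁.lattice.toSubmodule, n • x ∈ relConductor Λ₁ Λ₂ := by
  obtain ⟨n, hn, h⟩ := exists_nsmul_le_of_isLattice Λ₁.isLattice Λ₂.isLattice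
  refine ⟨n, hn, fun x hx => mem_relConductor.2 fun y hy => ?_⟩
  rw [smul_mul_assoc]
  exact h _ (Λ₁.toSubalgebra.mul_mem hx hy)

variable (Λ₁ Λ₂) in
theorem isLattice_relConductor : (relConductor Λ₁ Λ₂).IsLattice ℚ := by
  obtain ⟨n, hn, h⟩ := exists_nsmul_mem_relConductor Λ₁ Λ₂
  refine isLattice_of_nsmul_le Λ₁.isLattice ?_ hn h
  have : IsNoetherian ℤ Λ₂.lattice.toSubmodule :=
    isNoetherian_of_fg_of_noetherian _ Λ₂.isLattice.fg
  exact Submodule.FG.of_le Λ₂.isLattice.fg relConductor_le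

variable (Λ₁ Λ₂) in
theorem isGreatest_relConductor :
    IsGreatest {L : Submodule ℤ A | L.IsLattice ℚ ∧ Λ₁.lattice.toSubmodule ≤ L / L ∧
      L ≤ Λ₂.lattice.toSubmodule} (relConductor Λ₁ Λ₂) := by
  refine ⟨⟨isLattice_relConductor Λ₁ Λ₂, fun x hx => ?_, relConductor_le⟩, ?_⟩
  · refine Submodule.mem_div_iff_forall_mul_mem.2 fun y hy => ?_
    rw [mul_comm]
    exact mul_mem_relConductor hy hx
  · rintro L ⟨-, h1, h2⟩ x hx
    refine mem_relConductor.2 fun y hy => ?_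
    rw [mul_comm]
    exact h2 (Submodule.mem_div_iff_forall_mul_mem.1 (h1 hy) x hx)

theorem localize_relConductor_le (p : Nat.Primes) :
    localize p (relConductor Λ₁ Λ₂) ≤ Subalgebra.toSubmodule (Λ₂.loc p) :=
  localize_mono p relConductor_le

theorem mul_mem_localize_relConductor {p : Nat.Primes} {x y : A}
    (hx : x ∈ localize p (relConductor Λ₁ Λ₂)) (hy : y ∈ Λ₁.loc p) :
    x * y ∈ localize p (relConductor Λ₁ Λ₂) := by
  have h1 : relConductor Λ₁ Λ₂ * Λ₁.lattice.toSubmodule ≤ relConductor Λ₁ Λ₂ :=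
    Submodule.mul_le.2 fun x hx y hy => mul_mem_relConductor hx hy
  have h2 := localize_mono p h1
  rw [localize_mul] at h2
  exact h2 (Submodule.mul_mem_mul hx hy)

theorem loc_le_localize_relConductor {p : Nat.Primes} (hp : p ∉ P₀ Λ₁ Λ₂) :
    Subalgebra.toSubmodule (Λ₁.loc p) ≤ localize p (relConductor Λ₁ Λ₂) := by
  obtain ⟨n, hn, h⟩ := exists_not_dvd_nsmul_le (p := p) (M := Λ₂.lattice.toSubmodule)
    Λ₁.isLattice.fg (by rw [← localize_eq_of_notMem hp]; exact le_localize p _)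
  refine le_localize_of_nsmul hn fun x hx => mem_relConductor.2 fun y hy => ?_
  rw [smul_mul_assoc]
  exact h _ (Λ₁.toSubalgebra.mul_mem hx hy)

end Conductor

/-! ### Unit groups modulo the conductor and local unit groups -/

section UnitQuotients

theorem UnitQuot.mk_surjective {R S : Type*} [CommRing R] [CommRing S] (f : R →+* S) :
    Function.Surjective (UnitQuot.mk f) := QuotientGroup.mk'_surjective _

theorem UnitQuot.ker_mk {R S : Type*} [CommRing R] [CommRing S] (f : R →+* S) :
    (UnitQuot.mk f).ker = (Units.map (f : R →* S)).range := QuotientGroup.ker_mk' _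

theorem UnitQuot.mk_eq_one_iff {R S : Type*} [CommRing R] [CommRing S] (f : R →+* S) (u : Sˣ) :
    UnitQuot.mk f u = 1 ↔ u ∈ (Units.map (f : R →* S)).range := by
  rw [← UnitQuot.ker_mk, MonoidHom.mem_ker]

/-- The isomorphism `Sˣ / Rˣ ≃ H` induced by a surjection `Sˣ → H` whose kernel is the image
of `Rˣ`. -/
noncomputable def UnitQuot.equivOfSurjective {R S H : Type*} [CommRing R] [CommRing S] [Group H]
    (f : R →+* S) (g : Sˣ →* H) (hg : Function.Surjective g)
    (hk : g.ker = (Units.map (f : R →* S)).range) : UnitQuot f ≃* H :=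
  (QuotientGroup.quotientMulEquivOfEq hk.symm).trans
    (QuotientGroup.quotientKerEquivOfSurjective g hg)

theorem UnitQuot.equivOfSurjective_mk {R S H : Type*} [CommRing R] [CommRing S] [Group H]
    (f : R →+* S) (g : Sˣ →* H) (hg : Function.Surjective g)
    (hk : g.ker = (Units.map (f : R →* S)).range) (u : Sˣ) :
    UnitQuot.equivOfSurjective f g hg hk (UnitQuot.mk f u) = g u := rfl

variable {A : Type*} [CommRing A] [Algebra ℚ A] {Λ₁ Λ₂ : Order A}
  (h : Λ₂.toSubalgebra ≤ Λ₁.toSubalgebra)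

theorem locUnitsProj_surjective : Function.Surjective (locUnitsProj h) := fun y => by
  choose d hd using fun p : P₀ Λ₁ Λ₂ =>
    UnitQuot.mk_surjective (incl (Order.loc_mono p.1 h)) (y p)
  exact ⟨d, funext hd⟩

theorem locUnitsProj_eq_one_iff' (d : ∀ p : P₀ Λ₁ Λ₂, (Λ₁.loc p)ˣ) :
    locUnitsProj h d = 1 ↔ ∀ p, d p ∈ Set.range (unitsIncl (Order.loc_mono p.1 h)) := by
  rw [funext_iff]
  exact forall_congr' fun p => UnitQuot.mk_eq_one_iff _ (d p)

theorem locUnitsProj_eq_one_iff (d : ∀ p : P₀ Λ₁ Λ₂, (Λ₁.loc p)ˣ) :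
    locUnitsProj h d = 1 ↔ d ∈ Set.range (locUnitsIncl h) := by
  rw [locUnitsProj_eq_one_iff']
  constructor
  · intro hd
    choose u hu using hd
    exact ⟨u, funext hu⟩
  · rintro ⟨u, rfl⟩ p
    exact ⟨u p, rfl⟩

/-- The units `d_p` of `(Λ₁)_(p)` represent `a` modulo the localized conductor, for all
`p ∈ P₀`. -/
def Represents (a : Λ₁.toSubalgebra) (d : ∀ p : P₀ Λ₁ Λ₂, (Λ₁.loc p)ˣ) : Prop :=
  ∀ p : P₀ Λ₁ Λ₂, ((d p : Λ₁.loc p) : A) - (a : A) ∈ localize p (relConductor Λ₁ Λ₂)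

theorem Represents.mul {a b : Λ₁.toSubalgebra} {d e : ∀ p : P₀ Λ₁ Λ₂, (Λ₁.loc p)ˣ}
    (hd : Represents a d) (he : Represents b e) : Represents (a * b) (d * e) := fun p => by
  have h1 : (((d * e) p : Λ₁.loc p) : A) - ((a * b : Λ₁.toSubalgebra) : A) =
      ((d p : Λ₁.loc p) - a : A) * (e p : Λ₁.loc p) + ((e p : Λ₁.loc p) - b : A) * a := by
    change ((d p : Λ₁.loc p) : A) * (e p : Λ₁.loc p) - (a : A) * b = _
    ring
  rw [h1]
  exact add_mem (mul_mem_localize_relConductor (hd p) (e p : Λ₁.loc p).2)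
    (mul_mem_localize_relConductor (he p) (Λ₁.le_loc p a.2))

theorem exists_represents {a b : Λ₁.toSubalgebra} (hab : a * b - 1 ∈ conductorIdeal Λ₁ Λ₂) :
    ∃ d : ∀ p : P₀ Λ₁ Λ₂, (Λ₁.loc p)ˣ, Represents a d := by
  choose z d hz hd using fun p : P₀ Λ₁ Λ₂ => Λ₁.exists_unit_loc_sub_mem p _ hab
  refine ⟨d, fun p => ?_⟩
  rw [hd]
  exact le_localize _ _ (hz p)

theorem Represents.locUnitsProj_eq {a a' : Λ₁.toSubalgebra} (haa : a - a' ∈ conductorIdeal Λ₁ Λ₂)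
    {d d' : ∀ p : P₀ Λ₁ Λ₂, (Λ₁.loc p)ˣ} (hd : Represents a d) (hd' : Represents a' d') :
    locUnitsProj h d = locUnitsProj h d' := by
  rw [← inv_mul_eq_one, ← map_inv, ← map_mul, locUnitsProj_eq_one_iff']
  intro p
  have h1 : ((d p : Λ₁.loc p) : A) - (d' p : Λ₁.loc p) ∈ localize p (relConductor Λ₁ Λ₂) := by
    have h2 := sub_mem (add_mem (hd p) (le_localize p _ haa)) (hd' p)
    convert h2 using 1
    push_cast
    ring
  have key : ∀ u v : (Λ₁.loc p)ˣ, ((u : Λ₁.loc p) : A) - (v : Λ₁.loc p) ∈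
      localize p (relConductor Λ₁ Λ₂) → (((u⁻¹ * v : (Λ₁.loc p)ˣ) : Λ₁.loc p) : A) ∈ Λ₂.loc p := by
    intro u v huv
    have h3 : (((u⁻¹ * v : (Λ₁.loc p)ˣ) : Λ₁.loc p) : A) =
        1 - ((u : Λ₁.loc p) - (v : Λ₁.loc p) : A) * ((u⁻¹ : (Λ₁.loc p)ˣ) : Λ₁.loc p) := by
      have h4 : ((u : Λ₁.loc p) : A) * ((u⁻¹ : (Λ₁.loc p)ˣ) : Λ₁.loc p) = 1 :=
        congrArg Subtype.val u.mul_inv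
      push_cast
      linear_combination h4
    rw [h3]
    exact sub_mem (one_mem _) (localize_relConductor_le _
      (mul_mem_localize_relConductor huv (Subtype.property _)))
  refine (mem_range_unitsIncl_iff _ _).2 ⟨key _ _ h1, ?_⟩
  have h5 : ((d⁻¹ * d') p)⁻¹ = (d' p)⁻¹ * d p := by simp
  rw [h5]
  refine key _ _ ?_
  rw [← neg_sub]
  exact neg_mem h1

theorem exists_mem_represents (d : ∀ p : P₀ Λ₁ Λ₂, (Λ₁.loc p)ˣ) :
    ∃ a : Λ₁.toSubalgebra, Represents a d := by
  obtain ⟨n, hn, hC⟩ := exists_nsmul_mem_relConductor Λ₁ Λ₂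
  obtain ⟨a, ha, had⟩ := exists_sub_mem_localize hn hC (finite_P₀ Λ₁ Λ₂)
    (fun p => (extendUnits d p : A)) (fun p hp => by
      rw [extendUnits_of_mem d ⟨p, hp⟩]; exact (d ⟨p, hp⟩ : Λ₁.loc p).2)
  refine ⟨⟨a, ha⟩, fun p => ?_⟩
  have := had p p.2
  rwa [extendUnits_of_mem] at this

theorem mem_conductorIdeal_of_represents_one {a : Λ₁.toSubalgebra}
    (ha : Represents a (1 : ∀ p : P₀ Λ₁ Λ₂, (Λ₁.loc p)ˣ)) : a - 1 ∈ conductorIdeal Λ₁ Λ₂ := by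
  change ((a - 1 : Λ₁.toSubalgebra) : A) ∈ relConductor Λ₁ Λ₂
  refine mem_of_forall_mem_localize fun p => ?_
  by_cases hp : p ∈ P₀ Λ₁ Λ₂
  · have := neg_mem (ha ⟨p, hp⟩)
    rw [neg_sub] at this
    exact this
  · exact loc_le_localize_relConductor hp (Λ₁.le_loc p (a - 1).2)

theorem exists_unit_represents (d : ∀ p : P₀ Λ₁ Λ₂, (Λ₁.loc p)ˣ) :
    ∃ (u : (ModC Λ₁ Λ₂)ˣ) (a : Λ₁.toSubalgebra), (u : ModC Λ₁ Λ₂) = Ideal.Quotient.mk _ a ∧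
      Represents a d := by
  obtain ⟨a, ha⟩ := exists_mem_represents d
  obtain ⟨b, hb⟩ := exists_mem_represents d⁻¹
  have hab := mem_conductorIdeal_of_represents_one (a := a * b) (by simpa using ha.mul hb)
  exact ⟨Units.mkOfMulEqOne (Ideal.Quotient.mk _ a) (Ideal.Quotient.mk _ b) (by
    rw [← map_mul, ← map_one (Ideal.Quotient.mk (conductorIdeal Λ₁ Λ₂)), Ideal.Quotient.eq]
    exact hab), a, rfl, ha⟩

theorem exists_represents_of_unit (u : (ModC Λ₁ Λ₂)ˣ) {a : Λ₁.toSubalgebra}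
    (hu : (u : ModC Λ₁ Λ₂) = Ideal.Quotient.mk _ a) :
    ∃ d : ∀ p : P₀ Λ₁ Λ₂, (Λ₁.loc p)ˣ, Represents a d := by
  obtain ⟨b, hb⟩ := Ideal.Quotient.mk_surjective ((u⁻¹ : (ModC Λ₁ Λ₂)ˣ) : ModC Λ₁ Λ₂)
  refine exists_represents (b := b) ?_
  rw [← Ideal.Quotient.eq, map_mul, map_one, hb, ← hu, Units.mul_inv]

theorem exists_represents_units (u : (ModC Λ₁ Λ₂)ˣ) :
    ∃ (a : Λ₁.toSubalgebra) (d : ∀ p : P₀ Λ₁ Λ₂, (Λ₁.loc p)ˣ),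
      (u : ModC Λ₁ Λ₂) = Ideal.Quotient.mk _ a ∧ Represents a d := by
  obtain ⟨a, ha⟩ := Ideal.Quotient.mk_surjective (u : ModC Λ₁ Λ₂)
  obtain ⟨d, hd⟩ := exists_represents_of_unit u ha.symm
  exact ⟨a, d, ha.symm, hd⟩

/-- The homomorphism `(Λ₁/C)ˣ → ∏ (Λ₁)_(p)ˣ / (Λ₂)_(p)ˣ` that sends `a + C` to the class of
any tuple of units `d_p ∈ a + C_(p)`. -/
noncomputable def modCToLoc : (ModC Λ₁ Λ₂)ˣ →* (∀ p : P₀ Λ₁ Λ₂, LocUnitsQuot h p) :=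
  MonoidHom.mk' (fun u => locUnitsProj h (exists_represents_units u).choose_spec.choose)
    fun u v => by
      obtain ⟨h1, h2⟩ := (exists_represents_units u).choose_spec.choose_spec
      obtain ⟨h3, h4⟩ := (exists_represents_units v).choose_spec.choose_spec
      obtain ⟨h5, h6⟩ := (exists_represents_units (u * v)).choose_spec.choose_spec
      rw [← map_mul]
      refine Represents.locUnitsProj_eq h ?_ h6 (h2.mul h4)
      rw [← Ideal.Quotient.eq, ← h5, map_mul, ← h1, ← h3, Units.val_mul]

theorem modCToLoc_eq (u : (ModC Λ₁ Λ₂)ˣ) {a : Λ₁.toSubalgebra}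
    (hu : (u : ModC Λ₁ Λ₂) = Ideal.Quotient.mk _ a) {d : ∀ p : P₀ Λ₁ Λ₂, (Λ₁.loc p)ˣ}
    (hd : Represents a d) : modCToLoc h u = locUnitsProj h d := by
  obtain ⟨h1, h2⟩ := (exists_represents_units u).choose_spec.choose_spec
  refine Represents.locUnitsProj_eq h ?_ h2 hd
  rw [← Ideal.Quotient.eq, ← h1, hu]

theorem modCToLoc_surjective : Function.Surjective (modCToLoc h) := fun y => by
  obtain ⟨d, rfl⟩ := locUnitsProj_surjective h y
  obtain ⟨u, a, hu, ha⟩ := exists_unit_represents d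
  exact ⟨u, modCToLoc_eq h u hu ha⟩

theorem mem_of_forall_mem_loc {a : A} (ha : a ∈ Λ₁.toSubalgebra)
    (h2 : ∀ p ∈ P₀ Λ₁ Λ₂, a ∈ Λ₂.loc p) : a ∈ Λ₂.toSubalgebra := by
  refine mem_of_forall_mem_localize (L := Λ₂.lattice.toSubmodule) fun p => ?_
  by_cases hp : p ∈ P₀ Λ₁ Λ₂
  · exact h2 p hp
  · rw [← localize_eq_of_notMem hp]
    exact Λ₁.le_loc p ha

theorem Represents.mem_loc_iff {a : Λ₁.toSubalgebra} {d : ∀ p : P₀ Λ₁ Λ₂, (Λ₁.loc p)ˣ}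
    (hd : Represents a d) (p : P₀ Λ₁ Λ₂) :
    ((d p : Λ₁.loc p) : A) ∈ Λ₂.loc p ↔ (a : A) ∈ Λ₂.loc p := by
  have h1 := localize_relConductor_le _ (hd p)
  constructor
  · intro h2
    have := sub_mem h2 h1
    rwa [sub_sub_cancel] at this
  · intro h2
    have := add_mem h1 h2
    rwa [sub_add_cancel] at this

theorem modCIncl_injective : Function.Injective (modCIncl h) :=
  Ideal.quotientMap_injective' le_rfl

theorem ker_modCToLoc :
    (modCToLoc h).ker = (Units.map (modCIncl h : ModC' h →* ModC Λ₁ Λ₂)).range := by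
  ext u
  rw [MonoidHom.mem_ker]
  constructor
  · intro hu
    obtain ⟨a, d, h1, h2⟩ := exists_represents_units u
    obtain ⟨b, e, h3, h4⟩ := exists_represents_units u⁻¹
    have key : ∀ (v : (ModC Λ₁ Λ₂)ˣ) (x : Λ₁.toSubalgebra) (d : ∀ p : P₀ Λ₁ Λ₂, (Λ₁.loc p)ˣ),
        modCToLoc h v = 1 → (v : ModC Λ₁ Λ₂) = Ideal.Quotient.mk _ x → Represents x d →
        (x : A) ∈ Λ₂.toSubalgebra := by
      intro v x d hv hx hd
      rw [modCToLoc_eq h v hx hd, locUnitsProj_eq_one_iff'] at hv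
      exact mem_of_forall_mem_loc x.2 fun p hp => (hd.mem_loc_iff ⟨p, hp⟩).1
        ((mem_range_unitsIncl_iff _ _).1 (hv ⟨p, hp⟩)).1
    have ha := key u a d hu h1 h2
    have hb := key u⁻¹ b e (by rw [map_inv, hu, inv_one]) h3 h4
    have h5 : modCIncl h (Ideal.Quotient.mk _ ⟨a, ha⟩) = u := h1.symm
    have h6 : modCIncl h (Ideal.Quotient.mk _ ⟨b, hb⟩) = (u⁻¹ : (ModC Λ₁ Λ₂)ˣ) := h3.symm
    refine ⟨Units.mkOfMulEqOne (Ideal.Quotient.mk _ ⟨a, ha⟩) (Ideal.Quotient.mk _ ⟨b, hb⟩)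
      (modCIncl_injective h ?_), Units.ext h5⟩
    rw [map_mul, h5, h6, map_one, Units.mul_inv]
  · rintro ⟨v, rfl⟩
    have key : ∀ (v : (ModC' h)ˣ) (d : ∀ p : P₀ Λ₁ Λ₂, (Λ₁.loc p)ˣ) (a : Λ₁.toSubalgebra),
        (Units.map (modCIncl h : ModC' h →* ModC Λ₁ Λ₂) v : ModC Λ₁ Λ₂) = Ideal.Quotient.mk _ a →
        Represents a d → ∀ p : P₀ Λ₁ Λ₂, ((d p : Λ₁.loc p) : A) ∈ Λ₂.loc p := by
      intro v d a h1 h2 p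
      obtain ⟨x, hx⟩ := Ideal.Quotient.mk_surjective (v : ModC' h)
      have h3 : Ideal.Quotient.mk (conductorIdeal Λ₁ Λ₂) a =
          Ideal.Quotient.mk (conductorIdeal Λ₁ Λ₂) (incl h x) := by
        rw [← h1]
        change modCIncl h (v : ModC' h) = _
        rw [← hx]; rfl
      have h4 : (a : A) - x ∈ relConductor Λ₁ Λ₂ := Ideal.Quotient.eq.1 h3
      rw [h2.mem_loc_iff]
      have h5 := add_mem (relConductor_le h4) x.2
      rw [sub_add_cancel] at h5
      exact Λ₂.le_loc p h5
    set f := Units.map (modCIncl h : ModC' h →* ModC Λ₁ Λ₂)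
    obtain ⟨a, d, h1, h2⟩ := exists_represents_units (f v)
    obtain ⟨b, e, h3, h4⟩ := exists_represents_units (f v⁻¹)
    have h5 : modCToLoc h (f v) = locUnitsProj h e⁻¹ := by
      rw [map_inv (locUnitsProj h), ← modCToLoc_eq h _ h3 h4, map_inv, map_inv, inv_inv]
    have h6 := modCToLoc_eq h _ h1 h2
    rw [h6, locUnitsProj_eq_one_iff']
    intro p
    refine (mem_range_unitsIncl_iff _ _).2 ⟨key v d a h1 h2 p, ?_⟩
    -- the inverse of `d p` agrees with `e p` up to a unit of `(Λ₂)_(p)`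
    have h7 : locUnitsProj h (d * e) = 1 := by
      rw [map_mul, ← h6, h5, map_inv, inv_mul_cancel]
    rw [locUnitsProj_eq_one_iff'] at h7
    have h8 := ((mem_range_unitsIncl_iff _ _).1 (h7 p)).2
    have h9 : (d p)⁻¹ = ((d * e) p)⁻¹ * e p := by simp
    rw [h9]
    exact mul_mem h8 (key v⁻¹ e b h3 h4 p)

/-- The natural isomorphism `(Λ₁/C)ˣ / (Λ₂/C)ˣ ≃ ∏ (Λ₁)_(p)ˣ / (Λ₂)_(p)ˣ`. -/
noncomputable def modCUnitsEquiv :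
    ModCUnitsQuot h ≃* (∀ p : P₀ Λ₁ Λ₂, LocUnitsQuot h p) :=
  UnitQuot.equivOfSurjective _ (modCToLoc h) (modCToLoc_surjective h) (ker_modCToLoc h)

theorem modCUnitsEquiv_mk (u : (ModC Λ₁ Λ₂)ˣ) :
    modCUnitsEquiv h (UnitQuot.mk _ u) = modCToLoc h u :=
  UnitQuot.equivOfSurjective_mk _ _ _ _ u

end UnitQuotients

/-! ### The quotient of local unit groups as a group of lattices -/

section Kernel

variable {A : Type*} [CommRing A] [Algebra ℚ A]

variable {Λ₁ Λ₂ : Order A} (h : Λ₂.toSubalgebra ≤ Λ₁.toSubalgebra)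

/-- The homomorphism `∏ (Λ₁)_(p)ˣ / (Λ₂)_(p)ˣ → G(Λ₂)` induced by `glueHom`. -/
noncomputable def quotGlueHom : (∀ p : P₀ Λ₁ Λ₂, LocUnitsQuot h p) →* GLat Λ₂ :=
  (locUnitsProj h).liftOfSurjective (locUnitsProj_surjective h) ⟨glueHom Λ₁ Λ₂, fun d hd =>
    (glueHom_eq_one_iff h d).2 ((locUnitsProj_eq_one_iff h d).1 hd)⟩

theorem quotGlueHom_proj (d : ∀ p : P₀ Λ₁ Λ₂, (Λ₁.loc p)ˣ) :
    quotGlueHom h (locUnitsProj h d) = glueHom Λ₁ Λ₂ d :=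
  MonoidHom.liftOfRightInverse_comp_apply _ _ _ _ d

theorem quotGlueHom_injective : Function.Injective (quotGlueHom h) := by
  rw [injective_iff_map_eq_one]
  intro x hx
  obtain ⟨d, rfl⟩ := locUnitsProj_surjective h x
  rw [quotGlueHom_proj, glueHom_eq_one_iff h] at hx
  exact (locUnitsProj_eq_one_iff h d).2 hx

theorem range_quotGlueHom : (quotGlueHom h).range = (extLat h).ker := by
  ext L
  rw [MonoidHom.mem_ker, extLat_eq_one_iff]
  constructor
  · rintro ⟨x, rfl⟩
    obtain ⟨d, rfl⟩ := locUnitsProj_surjective h x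
    exact ⟨d, (quotGlueHom_proj h d).symm⟩
  · rintro ⟨d, rfl⟩
    exact ⟨locUnitsProj h d, quotGlueHom_proj h d⟩

/-- The isomorphism from `∏ (Λ₁)_(p)ˣ / (Λ₂)_(p)ˣ` to the kernel of `G(Λ₂) → G(Λ₁)`. -/
noncomputable def quotGlueEquiv : (∀ p : P₀ Λ₁ Λ₂, LocUnitsQuot h p) ≃* (extLat h).ker :=
  (MonoidHom.ofInjective (quotGlueHom_injective h)).trans
    (MulEquiv.subgroupCongr (range_quotGlueHom h))

theorem coe_quotGlueEquiv (x : ∀ p : P₀ Λ₁ Λ₂, LocUnitsQuot h p) :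
    (quotGlueEquiv h x : GLat Λ₂) = quotGlueHom h x := rfl

/-- At `p ∈ P₀` both sides localize to `d_p (Λ₂)_(p)`, because `d_p ∈ a + C_(p)` and
`C_(p) = d_p C_(p) ≤ d_p (Λ₂)_(p)`; at all other primes they localize to `(Λ₂)_(p)`. -/
theorem Represents.glueHom_eq (h : Λ₂.toSubalgebra ≤ Λ₁.toSubalgebra)
    {a : Λ₁.toSubalgebra} {d : ∀ p : P₀ Λ₁ Λ₂, (Λ₁.loc p)ˣ}
    (hd : Represents a d) : (glueHom Λ₁ Λ₂ d).1.toSubmodule =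
      relConductor Λ₁ Λ₂ ⊔ (a : A) • Λ₂.lattice.toSubmodule := by
  refine eq_of_forall_localize_eq fun p => ?_
  rw [localize_glueHom, localize_sup, localize_smul]
  by_cases hp : p ∈ P₀ Λ₁ Λ₂
  · have hdp := hd ⟨p, hp⟩
    rw [extendUnits_of_mem d ⟨p, hp⟩, coe_subUnits]
    set u := d ⟨p, hp⟩
    have hC : localize p (relConductor Λ₁ Λ₂) ≤
        ((u : Λ₁.loc p) : A) • localize p Λ₂.lattice.toSubmodule := fun x hx => by
      have h1 : x = ((u : Λ₁.loc p) : A) • (x * ((u⁻¹ : (Λ₁.loc p)ˣ) : Λ₁.loc p) : A) := by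
        have h2 : ((u : Λ₁.loc p) : A) * ((u⁻¹ : (Λ₁.loc p)ˣ) : Λ₁.loc p) = 1 :=
          congrArg Subtype.val u.mul_inv
        rw [smul_eq_mul]
        linear_combination (-x) * h2
      rw [h1]
      exact Submodule.smul_mem_pointwise_smul _ _ _ (localize_relConductor_le p
        (mul_mem_localize_relConductor hx (Subtype.property _)))
    have hmul : ∀ y ∈ localize p Λ₂.lattice.toSubmodule,
        ((u : Λ₁.loc p) - a : A) * y ∈ localize p (relConductor Λ₁ Λ₂) := fun y hy =>
      mul_mem_localize_relConductor hdp (Order.loc_mono p h hy)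
    apply le_antisymm
    · intro x hx
      obtain ⟨y, hy, rfl⟩ := (Submodule.mem_smul_pointwise_iff_exists _ _ _).1 hx
      rw [smul_eq_mul, ← sub_add_cancel ((u : Λ₁.loc p) : A) a, add_mul]
      exact Submodule.add_mem_sup (hmul y hy) (Submodule.smul_mem_pointwise_smul _ (a : A) _ hy)
    · refine sup_le hC fun x hx => ?_
      obtain ⟨y, hy, rfl⟩ := (Submodule.mem_smul_pointwise_iff_exists _ _ _).1 hx
      rw [smul_eq_mul, ← sub_sub_cancel ((u : Λ₁.loc p) : A) a, sub_mul]
      exact sub_mem (Submodule.smul_mem_pointwise_smul _ ((u : Λ₁.loc p) : A) _ hy)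
        (hC (hmul y hy))
  · rw [extendUnits_of_notMem d hp, Units.val_one, one_smul]
    apply le_antisymm
    · rw [← localize_eq_of_notMem hp]
      exact le_sup_of_le_left (loc_le_localize_relConductor hp)
    · refine sup_le (localize_relConductor_le p) fun x hx => ?_
      obtain ⟨y, hy, rfl⟩ := (Submodule.mem_smul_pointwise_iff_exists _ _ _).1 hx
      have ha : (a : A) ∈ localize p Λ₂.lattice.toSubmodule := by
        rw [← localize_eq_of_notMem hp]; exact Λ₁.le_loc p a.2
      exact (Λ₂.loc p).mul_mem ha hy

end Kernel

/-! ### Classes of invertible lattices -/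

section Classes

variable {A : Type*} [CommRing A] [Algebra ℚ A]

theorem epsClass_eq_iff {L M : FullLattice A} :
    epsClass L = epsClass M ↔ ∃ a : Aˣ, (a : A) • L.toSubmodule = M.toSubmodule :=
  Con.eq (epsCon A)

theorem toEps_surjective (Λ : Order A) : Function.Surjective (toEps Λ) := by
  rintro ⟨x, hx, y, hxy⟩
  obtain ⟨L, rfl⟩ : ∃ L, epsClass L = x := Quotient.exists_rep x
  obtain ⟨M, rfl⟩ : ∃ L, epsClass L = y := Quotient.exists_rep y
  rw [← epsClass_mul, epsClass_eq_iff] at hx hxy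
  obtain ⟨a, ha⟩ := hx
  obtain ⟨b, hb⟩ := hxy
  rw [FullLattice.mul_toSubmodule] at ha hb
  have hΛ : Λ.lattice.toSubmodule * Λ.lattice.toSubmodule = Λ.lattice.toSubmodule :=
    congrArg FullLattice.toSubmodule Λ.idem
  refine ⟨⟨L, FullLattice.ext ?_, M.unitSMul b, FullLattice.ext ?_⟩, rfl⟩
  · rw [FullLattice.mul_toSubmodule, ← ha, smul_mul_assoc, mul_assoc, hΛ]
  · rw [FullLattice.mul_toSubmodule, ← hb]
    exact mul_smul_comm _ _ _

/-- The homomorphism `Aˣ → G(Λ)`, `a ↦ aΛ`. -/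
noncomputable def principalLat (Λ : Order A) : Aˣ →* GLat Λ :=
  MonoidHom.mk' (fun a => mkGLat (fun _ => a) (Λ.lattice.unitSMul a) (Λ.lattice.unitSMul a⁻¹)
    (fun p => localize_smul p _ _) fun p => localize_smul p _ _) fun a b => by
    refine G.ext' (FullLattice.ext ?_)
    change ((a * b : Aˣ) : A) • Λ.lattice.toSubmodule =
      ((a : A) • Λ.lattice.toSubmodule) * ((b : A) • Λ.lattice.toSubmodule)
    rw [smul_mul_smul_comm, Units.val_mul]
    exact congrArg _ (congrArg FullLattice.toSubmodule Λ.idem).symm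

theorem toSubmodule_principalLat (Λ : Order A) (a : Aˣ) :
    (principalLat Λ a).1.toSubmodule = (a : A) • Λ.lattice.toSubmodule := rfl

theorem toEps_eq_one_iff {Λ : Order A} (L : GLat Λ) :
    toEps Λ L = 1 ↔ L ∈ Set.range (principalLat Λ) := by
  have h1 : toEps Λ L = 1 ↔ epsClass Λ.lattice = epsClass L.1 :=
    ⟨fun h => (congrArg Subtype.val h).symm, fun h => G.ext' h.symm⟩
  rw [h1, epsClass_eq_iff]
  exact exists_congr fun a => ⟨fun h => G.ext' (FullLattice.ext h), fun h => by rw [← h]; rfl⟩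

variable {Λ₁ Λ₂ : Order A} (h : Λ₂.toSubalgebra ≤ Λ₁.toSubalgebra)

theorem extEps_toEps (L : GLat Λ₂) : extEps h (toEps Λ₂ L) = toEps Λ₁ (extLat h L) := rfl

theorem extLat_principalLat (a : Aˣ) : extLat h (principalLat Λ₂ a) = principalLat Λ₁ a := by
  refine G.ext' (FullLattice.ext ?_)
  change Λ₁.lattice.toSubmodule * ((a : A) • Λ₂.lattice.toSubmodule) = _
  rw [mul_smul_comm]
  exact congrArg _ (congrArg FullLattice.toSubmodule (Order.lattice_mul h))

theorem principalLat_eq_one_iff {Λ : Order A} (a : Aˣ) :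
    principalLat Λ a = 1 ↔ ∃ u : (Λ.toSubalgebra)ˣ, subUnits _ u = a := by
  have h1 : principalLat Λ a = 1 ↔ (a : A) • Subalgebra.toSubmodule Λ.toSubalgebra =
      Subalgebra.toSubmodule Λ.toSubalgebra :=
    ⟨fun h => congrArg (fun L : GLat Λ => L.1.toSubmodule) h,
      fun h => G.ext' (FullLattice.ext h)⟩
  rw [h1, smul_subalgebra_eq_iff]
  exact exists_congr fun u => (Units.ext_iff (u := subUnits _ u) (v := a)).symm

/-- The homomorphism `∏ (Λ₁)_(p)ˣ / (Λ₂)_(p)ˣ → G([Λ₂]_ε)`. -/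
noncomputable def quotGlueEps : (∀ p : P₀ Λ₁ Λ₂, LocUnitsQuot h p) →* GEps Λ₂ :=
  (toEps Λ₂).comp (quotGlueHom h)

theorem quotGlueEps_proj (d : ∀ p : P₀ Λ₁ Λ₂, (Λ₁.loc p)ˣ) :
    quotGlueEps h (locUnitsProj h d) = toEps Λ₂ (glueHom Λ₁ Λ₂ d) :=
  congrArg (toEps Λ₂) (quotGlueHom_proj h d)

theorem mulExact_unitsIncl_diagUnits : Function.MulExact (unitsIncl h) (diagUnits h) := by
  intro u
  have h1 : diagUnits h u = 1 ↔ ∀ p : P₀ Λ₁ Λ₂,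
      unitsIncl (Λ₁.le_loc p) u ∈ Set.range (unitsIncl (Order.loc_mono p.1 h)) :=
    locUnitsProj_eq_one_iff' h _
  rw [h1, mem_range_unitsIncl_iff]
  constructor
  · intro h2
    exact ⟨mem_of_forall_mem_loc (Subtype.property _) fun p hp =>
        ((mem_range_unitsIncl_iff _ _).1 (h2 ⟨p, hp⟩)).1,
      mem_of_forall_mem_loc (Subtype.property _) fun p hp =>
        ((mem_range_unitsIncl_iff _ _).1 (h2 ⟨p, hp⟩)).2⟩
  · intro h2 p
    exact (mem_range_unitsIncl_iff _ _).2 ⟨Λ₂.le_loc p h2.1, Λ₂.le_loc p h2.2⟩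

theorem quotGlueHom_diagUnits (u : (Λ₁.toSubalgebra)ˣ) :
    quotGlueHom h (diagUnits h u) = principalLat Λ₂ (subUnits _ u) := by
  refine (quotGlueHom_proj h _).trans (G.ext' ((eq_glueHom_iff _ _).2 fun p => ?_)).symm
  rw [toSubmodule_principalLat, localize_smul]
  by_cases hp : p ∈ P₀ Λ₁ Λ₂
  · rw [extendUnits_of_mem _ ⟨p, hp⟩]; rfl
  · rw [extendUnits_of_notMem _ hp, Units.val_one, one_smul, ← localize_eq_of_notMem hp]
    exact (smul_subalgebra_eq_iff (S := Λ₁.loc p) _).2 ⟨unitsIncl (Λ₁.le_loc p) u, rfl⟩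

theorem mulExact_diagUnits_quotGlueEps : Function.MulExact (diagUnits h) (quotGlueEps h) := by
  intro x
  have h1 : quotGlueEps h x = 1 ↔ quotGlueHom h x ∈ Set.range (principalLat Λ₂) :=
    toEps_eq_one_iff _
  rw [h1]
  constructor
  · rintro ⟨a, ha⟩
    have h2 : principalLat Λ₁ a = 1 := by
      rw [← extLat_principalLat h, ha, ← MonoidHom.mem_ker, ← range_quotGlueHom]
      exact ⟨x, rfl⟩
    obtain ⟨u, rfl⟩ := (principalLat_eq_one_iff a).1 h2
    exact ⟨u, quotGlueHom_injective h (by rw [quotGlueHom_diagUnits, ha])⟩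
  · rintro ⟨u, rfl⟩
    exact ⟨_, (quotGlueHom_diagUnits h u).symm⟩

theorem mulExact_quotGlueEps_extEps : Function.MulExact (quotGlueEps h) (extEps h) := by
  intro y
  obtain ⟨L, rfl⟩ := toEps_surjective Λ₂ y
  rw [extEps_toEps, toEps_eq_one_iff]
  constructor
  · rintro ⟨a, ha⟩
    -- `a⁻¹ L` lies in the class of `L` and in the kernel of `G(Λ₂) → G(Λ₁)`
    have h1 : (principalLat Λ₂ a)⁻¹ * L ∈ (quotGlueHom h).range := by
      rw [range_quotGlueHom, MonoidHom.mem_ker, map_mul, map_inv, extLat_principalLat, ha,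
        inv_mul_cancel]
    obtain ⟨x, hx⟩ := h1
    refine ⟨x, ?_⟩
    change toEps Λ₂ (quotGlueHom h x) = _
    rw [hx, map_mul, map_inv, (toEps_eq_one_iff (principalLat Λ₂ a)).2 ⟨a, rfl⟩, inv_one, one_mul]
  · rintro ⟨x, hx⟩
    rw [← toEps_eq_one_iff, ← extEps_toEps, ← hx]
    have h1 : extLat h (quotGlueHom h x) = 1 := by
      rw [← MonoidHom.mem_ker, ← range_quotGlueHom]
      exact ⟨x, rfl⟩
    change toEps Λ₁ (extLat h (quotGlueHom h x)) = 1
    rw [h1, map_one]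

theorem extEps_surjective : Function.Surjective (extEps h) := fun y => by
  obtain ⟨L, rfl⟩ := toEps_surjective Λ₁ y
  obtain ⟨M, rfl⟩ := extLat_surjective h L
  exact ⟨toEps Λ₂ M, rfl⟩

end Classes

/-! ### Finiteness and orders of the groups in the exact sequences -/

section Finiteness

variable {A : Type*} [CommRing A] [Algebra ℚ A]

variable (Λ₁ Λ₂ : Order A)

theorem finite_modC : Finite (ModC Λ₁ Λ₂) := by
  obtain ⟨n, hn, hC⟩ := exists_nsmul_mem_relConductor Λ₁ Λ₂
  refine Λ₁.finite_quotient hn ?_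
  have := hC 1 Λ₁.toSubalgebra.one_mem
  rw [nsmul_one] at this
  exact this

variable {Λ₁ Λ₂} (h : Λ₂.toSubalgebra ≤ Λ₁.toSubalgebra)

theorem finite_modC' : Finite (ModC' h) := by
  have := finite_modC Λ₁ Λ₂
  exact Finite.of_injective _ (modCIncl_injective h)

theorem finite_locUnitsQuot : Finite (∀ p : P₀ Λ₁ Λ₂, LocUnitsQuot h p) := by
  have := finite_modC Λ₁ Λ₂
  exact Finite.of_surjective _ (modCToLoc_surjective h)

/-- Finiteness of the class group descends from an order to the orders contained in it. -/
theorem finite_GEps_of_le (h : Λ₂.toSubalgebra ≤ Λ₁.toSubalgebra)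
    (h1 : Finite (GEps Λ₁)) : Finite (GEps Λ₂) := by
  have hQ := finite_locUnitsQuot h
  have hker : Finite (extEps h).ker := by
    refine Finite.of_surjective (fun x => (⟨quotGlueEps h x, ?_⟩ : (extEps h).ker)) ?_
    · exact (mulExact_quotGlueEps_extEps h _).2 ⟨x, rfl⟩
    · rintro ⟨y, hy⟩
      obtain ⟨x, hx⟩ := (mulExact_quotGlueEps_extEps h y).1 hy
      exact ⟨x, Subtype.ext hx⟩
  apply Nat.finite_of_card_ne_zero
  rw [← Subgroup.card_mul_index (extEps h).ker, Subgroup.index_ker]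
  exact mul_ne_zero Nat.card_pos.ne' Nat.card_pos.ne'

theorem range_unitsIncl : (unitsIncl h).range = (diagUnits h).ker := by
  ext u
  exact (mulExact_unitsIncl_diagUnits h u).symm

theorem finiteIndex_range_unitsIncl : (unitsIncl h).range.FiniteIndex := by
  have := finite_locUnitsQuot h
  rw [range_unitsIncl]
  infer_instance

theorem card_locUnitsQuot_mul_card_modC' :
    Nat.card (∀ p : P₀ Λ₁ Λ₂, LocUnitsQuot h p) * Nat.card (ModC' h)ˣ =
      Nat.card (ModC Λ₁ Λ₂)ˣ := by
  have hinj : Function.Injective (Units.map (modCIncl h : ModC' h →* ModC Λ₁ Λ₂)) :=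
    Units.map_injective (modCIncl_injective h)
  rw [← Subgroup.card_mul_index (modCToLoc h).ker, Subgroup.index_ker,
    MonoidHom.range_eq_top.2 (modCToLoc_surjective h), Subgroup.card_top, ker_modCToLoc, mul_comm,
    Nat.card_congr (MonoidHom.ofInjective hinj).toEquiv]

theorem card_locUnitsQuot_mul_card_GEps :
    Nat.card (∀ p : P₀ Λ₁ Λ₂, LocUnitsQuot h p) * Nat.card (GEps Λ₁) =
      (unitsIncl h).range.index * Nat.card (GEps Λ₂) := by
  have h1 : (quotGlueEps h).range = (extEps h).ker := by
    ext y
    exact (mulExact_quotGlueEps_extEps h y).symm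
  have h2 : (diagUnits h).range = (quotGlueEps h).ker := by
    ext y
    exact (mulExact_diagUnits_quotGlueEps h y).symm
  rw [← Subgroup.card_mul_index (extEps h).ker, ← Subgroup.card_mul_index (quotGlueEps h).ker,
    Subgroup.index_ker, Subgroup.index_ker, MonoidHom.range_eq_top.2 (extEps_surjective h),
    Subgroup.card_top, range_unitsIncl, Subgroup.index_ker, h1, h2, mul_assoc]

end Finiteness

/-! ### Finiteness of class groups: passage to the reduced algebra -/

section Nilpotent

variable {A B : Type*} [CommRing A] [Algebra ℚ A] [CommRing B] [Algebra ℚ B]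

/-- The image of a full lattice under a surjective homomorphism of algebras. -/
def FullLattice.map (π : A →ₐ[ℚ] B) (hπ : Function.Surjective π) (L : FullLattice A) :
    FullLattice B where
  toSubmodule := L.toSubmodule.map (π.toRingHom.toIntAlgHom).toLinearMap
  isLattice :=
    { fg := L.isLattice.fg.map _
      span_eq_top := by
        change Submodule.span ℚ (π.toLinearMap '' L.toSubmodule) = ⊤
        rw [Submodule.span_image, L.isLattice.span_eq_top, Submodule.map_top,
          LinearMap.range_eq_top.2 hπ] }

theorem FullLattice.map_mul (π : A →ₐ[ℚ] B) (hπ : Function.Surjective π) (L M : FullLattice A) :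
    (L * M).map π hπ = L.map π hπ * M.map π hπ :=
  FullLattice.ext (Submodule.map_mul _ _ _)

/-- The image of an order under a surjective homomorphism of algebras. -/
def Order.map (π : A →ₐ[ℚ] B) (hπ : Function.Surjective π) (Λ : Order A) : Order B where
  toSubalgebra := Λ.toSubalgebra.map π.toRingHom.toIntAlgHom
  isLattice := (Λ.lattice.map π hπ).isLattice

/-- The homomorphism `G(Λ) → G(π(Λ))`, `L ↦ π(L)`. -/
noncomputable def mapGLat (π : A →ₐ[ℚ] B) (hπ : Function.Surjective π) (Λ : Order A) :
    GLat Λ →* GLat (Λ.map π hπ) :=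
  MonoidHom.mk' (fun L => ⟨L.1.map π hπ, by
      conv_rhs => rw [← L.2.1, FullLattice.map_mul]
      rfl, by
      obtain ⟨M, hM⟩ := L.2.2
      refine ⟨M.map π hπ, ?_⟩
      rw [← FullLattice.map_mul, hM]
      rfl⟩)
    fun L M => G.ext' (FullLattice.map_mul π hπ L.1 M.1)

/-- If the kernel of `π` consists of nilpotent elements, an invertible lattice `L` with
principal image is principal. After scaling, `π(L) = π(Λ)`, so that there are `x ∈ L` and
`y ∈ L⁻¹` over `1`; then `x y` is a unit of `Λ`, and hence `L = xΛ`. -/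
theorem toEps_eq_one_of_map (π : A →ₐ[ℚ] B) (hπ : Function.Surjective π)
    (hnil : ∀ x, π x = 0 → IsNilpotent x) {Λ : Order A} (L : GLat Λ)
    (hL : toEps _ (mapGLat π hπ Λ L) = 1) : toEps Λ L = 1 := by
  obtain ⟨b, hb⟩ := (toEps_eq_one_iff _).1 hL
  have hunit : ∀ x, IsUnit (π x) → IsUnit x := fun x hx => by
    obtain ⟨c, hc⟩ := hx.exists_right_inv
    obtain ⟨y, rfl⟩ := hπ c
    have h1 : IsNilpotent (x * y - 1) := hnil _ (by rw [map_sub, map_mul, hc, map_one, sub_self])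
    have h2 := h1.isUnit_add_one
    rw [sub_add_cancel] at h2
    exact isUnit_of_mul_isUnit_left h2
  obtain ⟨a, ha⟩ := hπ b
  obtain ⟨a, rfl⟩ := hunit a (ha ▸ b.isUnit)
  -- replace `L` by `a⁻¹ L`
  set N := (principalLat Λ a)⁻¹ * L with hN
  have hΛ : mapGLat π hπ Λ (principalLat Λ a) = principalLat (Λ.map π hπ) b := by
    refine G.ext' (FullLattice.ext ?_)
    change ((a : A) • Λ.lattice.toSubmodule).map (π.toRingHom.toIntAlgHom).toLinearMap =
      (b : B) • (Λ.lattice.map π hπ).toSubmodule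
    rw [← ha]
    ext x
    constructor
    · rintro ⟨_, ⟨y, hy, rfl⟩, rfl⟩
      exact ⟨π y, ⟨y, hy, rfl⟩, (_root_.map_mul π (a : A) y).symm⟩
    · rintro ⟨_, ⟨y, hy, rfl⟩, rfl⟩
      exact ⟨a * y, ⟨y, hy, rfl⟩, _root_.map_mul π (a : A) y⟩
  have hN1 : mapGLat π hπ Λ N = 1 := by
    rw [hN, _root_.map_mul, map_inv, hΛ, hb, inv_mul_cancel]
  have hLN : L = principalLat Λ a * N := by rw [hN, mul_inv_cancel_left]
  have key : ∀ N : GLat Λ, mapGLat π hπ Λ N = 1 → ∃ x ∈ N.1.toSubmodule, π x = 1 := by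
    intro N hN
    have h1 : (1 : B) ∈ (mapGLat π hπ Λ N).1.toSubmodule := by
      rw [hN]; exact (Λ.map π hπ).toSubalgebra.one_mem
    exact h1
  obtain ⟨x, hx, hx1⟩ := key N hN1
  obtain ⟨y, hy, hy1⟩ := key N⁻¹ (by rw [map_inv, hN1, inv_one])
  have hNN : N.1.toSubmodule * (N⁻¹).1.toSubmodule = Λ.lattice.toSubmodule :=
    congrArg (fun L : GLat Λ => L.1.toSubmodule) (mul_inv_cancel N)
  have hmul : ∀ z ∈ N.1.toSubmodule, z * y ∈ Λ.toSubalgebra := fun z hz => by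
    change z * y ∈ Λ.lattice.toSubmodule
    rw [← hNN]; exact Submodule.mul_mem_mul hz hy
  have hxy : IsUnit (⟨x * y, hmul x hx⟩ : Λ.toSubalgebra) := by
    obtain ⟨n, hn⟩ : IsNilpotent (x * y - 1) := hnil _ (by
      rw [map_sub, _root_.map_mul, hx1, hy1, map_one, mul_one, sub_self])
    have h1 : IsNilpotent ((⟨x * y, hmul x hx⟩ : Λ.toSubalgebra) - 1) :=
      ⟨n, Subtype.ext (by push_cast; exact hn)⟩
    have h2 := h1.isUnit_add_one
    rwa [sub_add_cancel] at h2
  obtain ⟨w, hw⟩ := hxy.exists_right_inv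
  have hw : x * y * w = 1 := congrArg Subtype.val hw
  obtain ⟨u, rfl⟩ := hunit x (by rw [hx1]; exact isUnit_one)
  have hNu : N = principalLat Λ u := by
    refine G.ext' (FullLattice.ext (le_antisymm (fun z hz => ?_) fun z hz => ?_))
    · refine ⟨z * y * w, Λ.toSubalgebra.mul_mem (hmul z hz) w.2, ?_⟩
      change (u : A) * (z * y * w) = z
      linear_combination z * hw
    · obtain ⟨l, hl, rfl⟩ := hz
      have h1 : N.1.toSubmodule * Λ.lattice.toSubmodule = N.1.toSubmodule :=
        congrArg FullLattice.toSubmodule N.2.1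
      rw [← h1]
      exact Submodule.mul_mem_mul hx hl
  rw [hLN, hNu, ← _root_.map_mul]
  exact (toEps_eq_one_iff _).2 ⟨_, rfl⟩

/-- A map from invertible lattices to a finite type whose fibres lie in single classes bounds
the number of classes. -/
theorem finite_GEps_of_forall_eq {Λ : Order A} {T : Type*} [Finite T] (f : GLat Λ → T)
    (hf : ∀ L M, f L = f M → toEps Λ L = toEps Λ M) : Finite (GEps Λ) := by
  refine Finite.of_injective (fun x => f (toEps_surjective Λ x).choose) fun x y hxy => ?_
  rw [← (toEps_surjective Λ x).choose_spec, ← (toEps_surjective Λ y).choose_spec]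
  exact hf _ _ hxy

theorem finite_GEps_of_map (π : A →ₐ[ℚ] B) (hπ : Function.Surjective π)
    (hnil : ∀ x, π x = 0 → IsNilpotent x) (Λ : Order A) [Finite (GEps (Λ.map π hπ))] :
    Finite (GEps Λ) := by
  refine finite_GEps_of_forall_eq (fun L => toEps _ (mapGLat π hπ Λ L)) fun L M h => ?_
  rw [← div_eq_one, ← map_div] at h ⊢
  rw [← map_div] at h
  exact toEps_eq_one_of_map π hπ hnil _ h

end Nilpotent

/-! ### Finiteness of class groups: products of number fields -/

section Reduced

open NumberField nonZeroDivisors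

section Coordinates

variable {A : Type*} [CommRing A] {ι : Type*} {K : ι → Type*} [∀ i, Field (K i)]

/-- The element of `A ≃ ∏ K i` with only one nonzero coordinate, the `i`-th, equal to `x`. -/
noncomputable def coordElem (e : A ≃+* ∀ i, K i) (i : ι) (x : K i) : A :=
  open Classical in e.symm (Pi.single i x)

theorem coordElem_add (e : A ≃+* ∀ i, K i) (i : ι) (x y : K i) :
    coordElem e i (x + y) = coordElem e i x + coordElem e i y := by
  simp only [coordElem, Pi.single_add, map_add]

theorem coordElem_zero (e : A ≃+* ∀ i, K i) (i : ι) : coordElem e i 0 = 0 := by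
  simp only [coordElem, Pi.single_zero, map_zero]

theorem coordElem_mul (e : A ≃+* ∀ i, K i) (i : ι) (x y : K i) :
    coordElem e i (x * y) = coordElem e i x * coordElem e i y := by
  simp only [coordElem, Pi.single_mul, map_mul]

theorem coordElem_apply (e : A ≃+* ∀ i, K i) (i : ι) (x : A) :
    coordElem e i (e x i) = coordElem e i 1 * x := by
  classical
  apply e.injective
  rw [map_mul]
  simp only [coordElem, RingEquiv.apply_symm_apply]
  ext j
  rcases eq_or_ne j i with rfl | hj
  · simp
  · simp [Pi.single_eq_of_ne hj]

theorem eq_sum_coordElem [Fintype ι] (e : A ≃+* ∀ i, K i) (x : A) :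
    x = ∑ i, coordElem e i (e x i) := by
  classical
  apply e.injective
  simp only [coordElem, map_sum, RingEquiv.apply_symm_apply]
  exact (Finset.univ_sum_single (e x)).symm

theorem isIntegral_coordElem (e : A ≃+* ∀ i, K i) (i : ι) {x : K i} (hx : IsIntegral ℤ x) :
    IsIntegral ℤ (coordElem e i x) := by
  classical
  obtain ⟨f, hf, hfx⟩ := hx
  refine ⟨Polynomial.X * f, Polynomial.monic_X.mul hf, e.injective ?_⟩
  have h1 : Polynomial.aeval (e (coordElem e i x)) (Polynomial.X * f) = 0 := by
    ext j
    have h2 := Polynomial.aeval_algHom_apply (Pi.evalAlgHom ℤ K j) (e (coordElem e i x))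
      (Polynomial.X * f)
    change _ = (Polynomial.aeval (e (coordElem e i x)) (Polynomial.X * f)) j at h2
    rw [← h2]
    change Polynomial.aeval (e (coordElem e i x) j) (Polynomial.X * f) = 0
    simp only [coordElem, RingEquiv.apply_symm_apply]
    rcases eq_or_ne j i with rfl | hj
    · rw [Pi.single_eq_same, map_mul]
      exact mul_eq_zero_of_right _ hfx
    · rw [Pi.single_eq_of_ne hj]; simp
  rw [map_zero, ← h1]
  exact (Polynomial.aeval_algHom_apply e.toRingHom.toIntAlgHom _ _).symm

/-- The integers of a finite product of number fields embed into the product of the rings of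
integers. -/
theorem finite_integralClosure [Finite ι] [∀ i, NumberField (K i)] (e : A ≃+* ∀ i, K i) :
    Module.Finite ℤ (integralClosure ℤ A) := by
  have hint : ∀ (x : integralClosure ℤ A) i, IsIntegral ℤ (e (x : A) i) := fun x i =>
    IsIntegral.map (((Pi.evalRingHom K i).comp e.toRingHom).toIntAlgHom) x.2
  let f : integralClosure ℤ A →ₗ[ℤ] (∀ i, 𝓞 (K i)) :=
    { toFun := fun x i => ⟨e (x : A) i, hint x i⟩
      map_add' := fun x y => by
        ext i
        change e ((x : A) + y) i = e (x : A) i + e (y : A) i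
        rw [map_add]; rfl
      map_smul' := fun n x => by
        ext i
        change e (n • (x : A)) i = ((n • (⟨e (x : A) i, hint x i⟩ : 𝓞 (K i)) : 𝓞 (K i)) : K i)
        rw [map_zsmul]
        simp }
  refine Module.Finite.of_injective f fun x y hxy => Subtype.ext (e.injective ?_)
  ext i
  exact congrArg (fun z : ∀ i, 𝓞 (K i) => ((z i : 𝓞 (K i)) : K i)) hxy

end Coordinates

variable {A : Type*} [CommRing A] [Algebra ℚ A]
  {ι : Type*} {K : ι → Type*} [∀ i, Field (K i)] [∀ i, NumberField (K i)]

variable (A) in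
/-- The maximal order of a finite product of number fields. -/
noncomputable def maximalOrder [Finite ι] [FiniteDimensional ℚ A] (e : A ≃+* ∀ i, K i) :
    Order A where
  toSubalgebra := integralClosure ℤ A
  isLattice :=
    { fg := Module.Finite.iff_fg.1 (finite_integralClosure e)
      span_eq_top := by
        rw [eq_top_iff]
        intro x _
        have hx : IsAlgebraic ℤ x := by
          rw [IsFractionRing.isAlgebraic_iff ℤ ℚ A]
          exact Algebra.IsAlgebraic.isAlgebraic x
        obtain ⟨n, hn, h⟩ := hx.exists_integral_multiple
        have h1 : (n : ℚ)⁻¹ • (n • x) = x := by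
          rw [← Int.cast_smul_eq_zsmul ℚ, smul_smul, inv_mul_cancel₀ (by exact_mod_cast hn),
            one_smul]
        rw [← h1]
        exact Submodule.smul_mem _ _ (Submodule.subset_span h) }

theorem le_maximalOrder [Finite ι] [FiniteDimensional ℚ A] (e : A ≃+* ∀ i, K i) (Λ : Order A) :
    Λ.toSubalgebra ≤ (maximalOrder A e).toSubalgebra := fun x hx =>
  IsIntegral.of_mem_of_fg Λ.toSubalgebra Λ.isLattice.fg x hx

/-- The `i`-th component of a full lattice in `A ≃ ∏ K i`, as a fractional ideal. -/
noncomputable def component (e : A ≃+* ∀ i, K i) (L : FullLattice A) (i : ι) :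
    FractionalIdeal (𝓞 (K i))⁰ (K i) :=
  ⟨Submodule.span (𝓞 (K i)) ((fun x => e x i) '' L.toSubmodule), by
    apply FractionalIdeal.isFractional_of_fg
    obtain ⟨s, hs⟩ := L.isLattice.fg
    classical
    refine ⟨s.image fun x => e x i, le_antisymm (Submodule.span_mono ?_) ?_⟩
    · rw [Finset.coe_image, ← hs]
      exact Set.image_mono Submodule.subset_span
    · rw [Submodule.span_le]
      rintro _ ⟨x, hx, rfl⟩
      rw [← hs] at hx
      induction hx using Submodule.span_induction with
      | mem x h => exact Submodule.subset_span (by simpa using ⟨x, h, rfl⟩)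
      | zero => simp
      | add x y _ _ h1 h2 => simpa using add_mem h1 h2
      | smul n x _ h =>
        simp only [map_zsmul, Pi.smul_apply]
        exact zsmul_mem h n⟩

theorem mem_component (e : A ≃+* ∀ i, K i) {L : FullLattice A} {x : A} (hx : x ∈ L.toSubmodule)
    (i : ι) : e x i ∈ component e L i :=
  Submodule.subset_span ⟨x, hx, rfl⟩

theorem component_ne_zero (e : A ≃+* ∀ i, K i) (L : FullLattice A) (i : ι) :
    component e L i ≠ 0 := by
  obtain ⟨n, hn, h⟩ := exists_nsmul_mem L.isLattice 1
  intro h0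
  have h1 := mem_component e h i
  rw [h0, FractionalIdeal.mem_zero_iff] at h1
  simp [hn] at h1

variable [FiniteDimensional ℚ A] [Finite ι]

/-- A lattice over the maximal order contains the idempotent parts of its elements, hence is the
product of its components. -/
theorem mem_of_forall_mem_component (e : A ≃+* ∀ i, K i) (L : GLat (maximalOrder A e)) {x : A}
    (hx : ∀ i, e x i ∈ component e L.1 i) : x ∈ L.1.toSubmodule := by
  have hL : ∀ y, IsIntegral ℤ y → ∀ z ∈ L.1.toSubmodule, y * z ∈ L.1.toSubmodule := by
    intro y hy z hz
    have h1 : L.1.toSubmodule * (maximalOrder A e).lattice.toSubmodule = L.1.toSubmodule :=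
      congrArg FullLattice.toSubmodule L.2.1
    rw [← h1, mul_comm y z]
    exact Submodule.mul_mem_mul hz hy
  have key : ∀ i, ∀ t ∈ component e L.1 i, coordElem e i t ∈ L.1.toSubmodule := by
    intro i t ht
    change t ∈ Submodule.span (𝓞 (K i)) _ at ht
    induction ht using Submodule.span_induction with
    | mem t h =>
      obtain ⟨x, hx, rfl⟩ := h
      change coordElem e i (e x i) ∈ _
      rw [coordElem_apply]
      exact hL _ (isIntegral_coordElem e i isIntegral_one) _ hx
    | zero => rw [coordElem_zero]; exact zero_mem _
    | add x y _ _ h1 h2 => rw [coordElem_add]; exact add_mem h1 h2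
    | smul o x _ h =>
      rw [show o • x = (o : K i) * x from rfl, coordElem_mul]
      exact hL _ (isIntegral_coordElem e i o.2) _ h
  have := Fintype.ofFinite ι
  rw [eq_sum_coordElem e x]
  exact sum_mem fun i _ => key i _ (hx i)

/-- Invertible lattices over the maximal order whose components have the same ideal classes
are equivalent. -/
theorem finite_GEps_maximalOrder (e : A ≃+* ∀ i, K i) : Finite (GEps (maximalOrder A e)) := by
  have hfin : ∀ i, Finite ((FractionalIdeal (𝓞 (K i))⁰ (K i))ˣ ⧸
      (toPrincipalIdeal (𝓞 (K i)) (K i)).range) := fun i =>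
    Finite.of_equiv _ (ClassGroup.equiv (R := 𝓞 (K i)) (K i)).toEquiv
  let I : GLat (maximalOrder A e) → ∀ i, (FractionalIdeal (𝓞 (K i))⁰ (K i))ˣ := fun L i =>
    Units.mk0 (component e L.1 i) (component_ne_zero e L.1 i)
  refine finite_GEps_of_forall_eq (T := ∀ i, (FractionalIdeal (𝓞 (K i))⁰ (K i))ˣ ⧸
    (toPrincipalIdeal (𝓞 (K i)) (K i)).range) (fun L i => QuotientGroup.mk (I L i))
    fun L M hLM => ?_
  have h1 : ∀ i, ∃ c : (K i)ˣ, toPrincipalIdeal (𝓞 (K i)) (K i) c = (I L i)⁻¹ * I M i :=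
    fun i => QuotientGroup.eq.1 (congrFun hLM i)
  choose c hc using h1
  have hmem : ∀ i x, x ∈ component e L.1 i → (c i : K i) * x ∈ component e M.1 i := by
    intro i x hx
    have h2 : toPrincipalIdeal (𝓞 (K i)) (K i) (c i) * I L i = I M i := by
      rw [hc, mul_comm, mul_inv_cancel_left]
    have h3 := congrArg (Units.val) h2
    rw [Units.val_mul, coe_toPrincipalIdeal] at h3
    change _ = component e M.1 i at h3
    rw [← h3]
    exact FractionalIdeal.mul_mem_mul (FractionalIdeal.mem_spanSingleton_self _ _) hx
  have hmem' : ∀ i x, x ∈ component e M.1 i → ((c i)⁻¹ : (K i)ˣ) * x ∈ component e L.1 i := by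
    intro i x hx
    have h2 : toPrincipalIdeal (𝓞 (K i)) (K i) (c i)⁻¹ * I M i = I L i := by
      rw [map_inv, hc, mul_inv_rev, inv_inv, mul_comm, mul_comm (I M i)⁻¹, mul_comm,
        inv_mul_cancel_right]
    have h3 := congrArg (Units.val) h2
    rw [Units.val_mul, coe_toPrincipalIdeal] at h3
    change _ = component e L.1 i at h3
    rw [← h3]
    exact FractionalIdeal.mul_mem_mul (FractionalIdeal.mem_spanSingleton_self _ _) hx
  let u : Aˣ := Units.map e.symm.toRingHom.toMonoidHom (MulEquiv.piUnits.symm c)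
  have hu : ∀ i, e (u : A) i = c i := fun i => by
    change e (e.symm _) i = _
    rw [RingEquiv.apply_symm_apply]; rfl
  have hu' : ∀ i, e ((u⁻¹ : Aˣ) : A) i = ((c i)⁻¹ : (K i)ˣ) := fun i => by
    change e (e.symm _) i = _
    rw [RingEquiv.apply_symm_apply]; rfl
  refine G.ext' (epsClass_eq_iff.2 ⟨u, le_antisymm ?_ fun y hy => ?_⟩)
  · rintro _ ⟨x, hx, rfl⟩
    refine mem_of_forall_mem_component e M fun i => ?_
    change e ((u : A) * x) i ∈ _
    rw [map_mul, Pi.mul_apply, hu]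
    exact hmem i _ (mem_component e hx i)
  · refine ⟨((u⁻¹ : Aˣ) : A) * y, mem_of_forall_mem_component e L fun i => ?_, ?_⟩
    · rw [map_mul, Pi.mul_apply, hu']
      exact hmem' i _ (mem_component e hy i)
    · change (u : A) * (((u⁻¹ : Aˣ) : A) * y) = y
      rw [← mul_assoc, Units.mul_inv, one_mul]

end Reduced

/-! ### Finiteness of class groups: arbitrary algebras -/

section General

variable {A : Type*} [CommRing A] [Algebra ℚ A] [FiniteDimensional ℚ A]

theorem numberField_of_surjective {K : Type*} [Field K] [CharZero K] (f : A →+* K)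
    (hf : Function.Surjective f) : NumberField K where
  to_finiteDimensional := Module.Finite.of_surjective f.toRatAlgHom.toLinearMap hf

theorem finite_GEps_of_isReduced [IsReduced A] (Λ : Order A) : Finite (GEps Λ) := by
  have : IsArtinianRing A := IsArtinianRing.of_finite ℚ A
  let _ : ∀ I : MaximalSpectrum A, Field (A ⧸ I.asIdeal) := fun I =>
    Ideal.Quotient.field I.asIdeal
  have hchar : ∀ I : MaximalSpectrum A, CharZero (A ⧸ I.asIdeal) := fun I =>
    algebraRat.charZero _
  have hnf : ∀ I : MaximalSpectrum A, NumberField (A ⧸ I.asIdeal) := fun I =>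
    numberField_of_surjective (Ideal.Quotient.mk I.asIdeal) Ideal.Quotient.mk_surjective
  let e : A ≃+* ∀ I : MaximalSpectrum A, A ⧸ I.asIdeal := (IsArtinianRing.equivPi A).toRingEquiv
  exact finite_GEps_of_le (le_maximalOrder e Λ) (finite_GEps_maximalOrder e)

theorem finite_GEps (Λ : Order A) : Finite (GEps Λ) := by
  have hred : IsReduced (A ⧸ nilradical A) :=
    (Ideal.isRadical_iff_quotient_reduced _).1 (Ideal.radical_isRadical _)
  have : Finite (GEps (Λ.map (Ideal.Quotient.mkₐ ℚ (nilradical A))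
    (Ideal.Quotient.mkₐ_surjective ℚ _))) := finite_GEps_of_isReduced _
  exact finite_GEps_of_map (Ideal.Quotient.mkₐ ℚ (nilradical A))
    (Ideal.Quotient.mkₐ_surjective ℚ _)
    (fun _ hx => mem_nilradical.1 (Ideal.Quotient.eq_zero_iff_mem.1 hx)) Λ

end General

end QAlg

/-! ### The exact sequences and the class number formula -/

theorem theorem8p2 {A : Type*} [CommRing A] [Algebra ℚ A] [FiniteDimensional ℚ A]
    (Λ₁ Λ₂ : QAlg.Order A) (h : Λ₂.toSubalgebra < Λ₁.toSubalgebra) :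
    -- the conductor is a full lattice, the set of exceptional primes is finite
    (relConductor Λ₁ Λ₂).IsLattice ℚ ∧ (P₀ Λ₁ Λ₂).Finite ∧
    -- the conductor is the biggest `Λ₁`-ideal in `Λ₂`
    Λ₁.lattice.toSubmodule ≤ relConductor Λ₁ Λ₂ / relConductor Λ₁ Λ₂ ∧
    IsGreatest {L : Submodule ℤ A | L.IsLattice ℚ ∧ Λ₁.lattice.toSubmodule ≤ L / L ∧
      L ≤ Λ₂.lattice.toSubmodule} (relConductor Λ₁ Λ₂) ∧
    -- the exact sequence for the groups of invertible lattices
    ∃ φ : (∀ p : P₀ Λ₁ Λ₂, (Λ₁.loc p)ˣ) →* GLat Λ₂,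
      (∀ a, (φ a).1.toSubmodule =
        ⨅ p, extendByOne a p • localize p Λ₂.lattice.toSubmodule) ∧
      (∀ a, ∀ L : FullLattice A, L = (φ a).1 ↔
        ∀ p, localize p L.toSubmodule =
          extendByOne a p • localize p Λ₂.lattice.toSubmodule) ∧
      Function.Injective (locUnitsIncl h.le) ∧
      Function.MulExact (locUnitsIncl h.le) φ ∧
      Function.MulExact φ (extLat h.le) ∧
      Function.Surjective (extLat h.le) ∧
    -- the natural isomorphism: the class of `a + C` goes to the class of any tuple of units `d_p ∈ a + C_(p)`
    ∃ ψ : ModCUnitsQuot h.le ≃* (∀ p : P₀ Λ₁ Λ₂, LocUnitsQuot h.le p),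
      (∀ (a : Λ₁.toSubalgebra) (u : (ModC Λ₁ Λ₂)ˣ),
        (u : ModC Λ₁ Λ₂) = Ideal.Quotient.mk _ a →
        (∃ d : ∀ p : P₀ Λ₁ Λ₂, (Λ₁.loc p)ˣ, ∀ p : P₀ Λ₁ Λ₂,
          ((d p : Λ₁.loc p) : A) - (a : A) ∈ localize p (relConductor Λ₁ Λ₂)) ∧
        (∀ d : ∀ p : P₀ Λ₁ Λ₂, (Λ₁.loc p)ˣ,
          (∀ p : P₀ Λ₁ Λ₂,
            ((d p : Λ₁.loc p) : A) - (a : A) ∈ localize p (relConductor Λ₁ Λ₂)) →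
          ψ (UnitQuot.mk _ u) = locUnitsProj h.le d)) ∧
    -- the resulting isomorphism onto the kernel, and its explicit form
    (∃ θ : ModCUnitsQuot h.le ≃* (extLat h.le).ker,
      (∀ x d, ψ x = locUnitsProj h.le d → (θ x : GLat Λ₂) = φ d) ∧
      (∀ (a : Λ₁.toSubalgebra) (u : (ModC Λ₁ Λ₂)ˣ),
        (u : ModC Λ₁ Λ₂) = Ideal.Quotient.mk _ a →
        (θ (UnitQuot.mk _ u) : GLat Λ₂).1.toSubmodule =
          relConductor Λ₁ Λ₂ ⊔ (a : A) • Λ₂.lattice.toSubmodule)) ∧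
    -- the exact sequence for the groups of classes
    (∃ χ : (∀ p : P₀ Λ₁ Λ₂, LocUnitsQuot h.le p) →* GEps Λ₂,
      (∀ a, χ (locUnitsProj h.le a) = toEps Λ₂ (φ a)) ∧
      Function.Injective (unitsIncl h.le) ∧
      Function.MulExact (unitsIncl h.le) (diagUnits h.le) ∧
      Function.MulExact (diagUnits h.le) χ ∧
      Function.MulExact χ (extEps h.le) ∧
      Function.Surjective (extEps h.le)) ∧
    -- finiteness and the class number formula
    (unitsIncl h.le).range.FiniteIndex ∧
    Finite (GEps Λ₂) ∧ Finite (GEps Λ₁) ∧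
    Finite (ModC Λ₁ Λ₂)ˣ ∧
    Finite (ModC' h.le)ˣ ∧
    (Nat.card (GEps Λ₂) : ℚ) / Nat.card (GEps Λ₁) =
      (Nat.card (ModC Λ₁ Λ₂)ˣ : ℚ) /
        Nat.card (ModC' h.le)ˣ *
        (1 / ((unitsIncl h.le).range.index : ℚ)) := by
  have hext : ∀ (a : ∀ p : P₀ Λ₁ Λ₂, (Λ₁.loc p)ˣ) p, localize p (glueHom Λ₁ Λ₂ a).1.toSubmodule =
      extendByOne a p • localize p Λ₂.lattice.toSubmodule := fun a p => by
    rw [localize_glueHom, coe_extendUnits]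
  have hfin₁ : Finite (GEps Λ₁) := finite_GEps Λ₁
  have hfin₂ : Finite (GEps Λ₂) := finite_GEps Λ₂
  have hC : Finite (ModC Λ₁ Λ₂) := finite_modC Λ₁ Λ₂
  have hC' : Finite (ModC' h.le) := finite_modC' h.le
  refine ⟨isLattice_relConductor Λ₁ Λ₂, finite_P₀ Λ₁ Λ₂, (isGreatest_relConductor Λ₁ Λ₂).1.2.1,
    isGreatest_relConductor Λ₁ Λ₂, glueHom Λ₁ Λ₂, fun a => ?_, fun a L => ?_,
    locUnitsIncl_injective h.le, glueHom_eq_one_iff h.le, extLat_eq_one_iff h.le,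
    extLat_surjective h.le, modCUnitsEquiv h.le, fun a u hu => ⟨exists_represents_of_unit u hu,
      fun d hd => ?_⟩, ⟨(modCUnitsEquiv h.le).trans (quotGlueEquiv h.le), fun x d hx => ?_,
      fun a u hu => ?_⟩, ⟨quotGlueEps h.le, quotGlueEps_proj h.le, unitsIncl_injective h.le,
      mulExact_unitsIncl_diagUnits h.le, mulExact_diagUnits_quotGlueEps h.le,
      mulExact_quotGlueEps_extEps h.le, extEps_surjective h.le⟩,
    finiteIndex_range_unitsIncl h.le, hfin₂, hfin₁, inferInstance, inferInstance, ?_⟩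
  · rw [← iInf_localize (glueHom Λ₁ Λ₂ a).1.toSubmodule]
    exact iInf_congr (hext a)
  · rw [eq_glueHom_iff]
    simp only [coe_extendUnits]
  · rw [modCUnitsEquiv_mk]
    exact modCToLoc_eq h.le u hu hd
  · rw [MulEquiv.trans_apply, coe_quotGlueEquiv, hx, quotGlueHom_proj]
  · obtain ⟨d, hd⟩ := exists_represents_of_unit u hu
    rw [MulEquiv.trans_apply, coe_quotGlueEquiv, modCUnitsEquiv_mk, modCToLoc_eq h.le u hu hd,
      quotGlueHom_proj, hd.glueHom_eq h.le]
  · have h1 := card_locUnitsQuot_mul_card_modC' h.le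
    have h2 := card_locUnitsQuot_mul_card_GEps h.le
    have hindex := (finiteIndex_range_unitsIncl h.le).index_ne_zero
    have hG : (Nat.card (GEps Λ₁) : ℚ) ≠ 0 := Nat.cast_ne_zero.2 Nat.card_pos.ne'
    have hM : (Nat.card (ModC' h.le)ˣ : ℚ) ≠ 0 := Nat.cast_ne_zero.2 Nat.card_pos.ne'
    have hI : ((unitsIncl h.le).range.index : ℚ) ≠ 0 := Nat.cast_ne_zero.2 hindex
    rw [← h1, Nat.cast_mul, mul_div_assoc, div_self hM, mul_one, mul_one_div, div_eq_div_iff hG hI]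
    exact_mod_cast (by rw [h2, mul_comm] : _)
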